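/- Let $a>b>0$, and consider the confocal family $\mathcal C_\lambda:\ \frac{x^2}{a-\lambda}+\frac{y^2}{b-\lambda}=1$ in the Euclidean plane. For a point $(x,y)$ let $\lambda_1\le\lambda_2$ be its Jacobi elliptic coordinates, i.e. the roots $t$ of $(a-t)(b-t)=x^2(b-t)+y^2(a-t)$. Let $k\ge1$, $l\ge0$, let $\beta_1,\dots,\beta_k\in(-\infty,b)$ be distinct and $\gamma_1,\dots,\gamma_l\in(b,a)$ be distinct, and let $\mathcal D$ be a bounded domain whose boundary is a union of finitely many arcs of the ellipses $\mathcal C_{\beta_1},\dots,\mathcal C_{\beta_k}$, of the hyperbolas $\mathcal C_{\gamma_1},\dots,\mathcal C_{\gamma_l}$, and of segments of the coordinate axes. Let $\beta_i<\alpha_0<b$ for all $i$. Billiard trajectories in $\mathcal D$ are polygonal lines with open sides in $\mathcal D$ which obey the reflection law at their vertices on $\partial\mathcal D$. At a vertex of $\partial\mathcal D$ where the boundary forms a convex right angle the particle returns along the same line, which counts as one reflection off each of the two sides; trajectories do not reach points of $\partial\mathcal D$ where the reflection is undefined. The conic $\mathcal C_{\alpha_0}$ is the caustic of a trajectory if it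 touches every line that contains a side of the trajectory. A reflection off $\mathcal C_{\beta_i}$ (respectively $\mathcal C_{\gamma_j}$) is from inside if $\lambda_1$ (respectively $\lambda_2$) has a local minimum along the trajectory there, and from outside if it has a local maximum. Suppose that there is a billiard trajectory in $\mathcal D$ with caustic $\mathcal C_{\alpha_0}$ which becomes closed (in position and direction) after - $n_i'$ reflections from inside and $n_i''$ reflections from outside off $\mathcal C_{\beta_i}$, $1\le i\le k$; - $m_j'$ reflections from inside and $m_j''$ reflections from outside off $\mathcal C_{\gamma_j}$, $1\le j\le l$; - a total of $p$ intersections with the $x$-axis and reflections off boundary segments on the $x$-axis; - a total of $q$ intersections with the $y$-axis and reflections off boundary segments on the $y$-axis. Then $$\sum_{i=1}^k(n_i'-n_i'')\bigl(\mathcal A(P_{\beta_i})-\mathcal A(P_{\alpha_0})\bigr)+\sum_{j=1}^l(m_j'-m_j'')\,\mathcal A(P_{\gamma_j})+p\,\mathcal A(P_b)-q\,\mathcal A(P_a)=0,$$ $$\sum_{j=1}^l(m_j'-m_j'')+p-q=0.$$ Here $\mathcal A(P)=\int_{P_0}^{P}\frac{dt}{s}$, modulo the periods of $\frac{dt}{s}$,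 is the Abel–Jacobi map, with an arbitrary base point $P_0$ on the affine curve, of the elliptic curve $$\Gamma:\ s^2=\mathcal P(t):=(a-t)(b-t)(\alpha_0-t),$$ and $P_\delta=(\delta,\sqrt{\mathcal P(\delta)})$, where $\sqrt{\mathcal P(\delta)}$ is the branch $\sqrt{a-\delta}\,\sqrt{b-\delta}\,\sqrt{\alpha_0-\delta}$ with principal square roots, that is, the nonnegative root for $\delta\le\alpha_0$ and the nonpositive root for $b\le\delta\le a$. -/

import Mathlib

open scoped Topology

noncomputable section

namespace ConfocalBilliard

/-- The Euclidean plane; `X 0` and `X 1` are the coordinates `x` and `y`. -/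
abbrev Plane : Type := EuclideanSpace ℝ (Fin 2)

/-! ### Confocal conics and Jacobi elliptic coordinates -/

/-- Equation (left side minus right side) of the conic
`C_δ : x² / (a - δ) + y² / (b - δ) = 1` of the confocal family (`δ ≠ a, b`). -/
def conicEq (a b δ : ℝ) (X : Plane) : ℝ :=
  X 0 ^ 2 / (a - δ) + X 1 ^ 2 / (b - δ) - 1

/-- The normal vector of the conic `C_δ` of the family at one of its points `X`
(half the gradient of the equation). -/
def conicNormal (a b δ : ℝ) (X : Plane) : Plane :=
  !₂[X 0 / (a - δ), X 1 / (b - δ)]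

/-- The line through `P` and `Q` is tangent to `C_δ`. -/
def IsTangentLine (a b δ : ℝ) (P Q : Plane) : Prop :=
  ∃ T : Plane, conicEq a b δ T = 0 ∧ T ∈ line[ℝ, P, Q] ∧
    inner ℝ (conicNormal a b δ T) (Q - P) = 0

/-- The elliptic coordinate `λ₁`: the smaller root `t` of
`(a - t) (b - t) = x² (b - t) + y² (a - t)`. -/
def lam1 (a b : ℝ) (X : Plane) : ℝ :=
  ((a + b - X 0 ^ 2 - X 1 ^ 2) -
    √((a + b - X 0 ^ 2 - X 1 ^ 2) ^ 2 - 4 * (a * b - b * X 0 ^ 2 - a * X 1 ^ 2))) / 2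

/-- The elliptic coordinate `λ₂`: the larger root of the same equation. -/
def lam2 (a b : ℝ) (X : Plane) : ℝ :=
  ((a + b - X 0 ^ 2 - X 1 ^ 2) +
    √((a + b - X 0 ^ 2 - X 1 ^ 2) ^ 2 - 4 * (a * b - b * X 0 ^ 2 - a * X 1 ^ 2))) / 2

/-! ### The domains -/

/-- The curves that may carry pieces of the boundary: `k` ellipses, `l` hyperbolas, and the
coordinate axes, which are the degenerate conics of the family. -/
inductive Wall (k l : ℕ) : Type
  | ellipse (i : Fin k)
  | hyperbola (j : Fin l)
  | xAxis
  | yAxis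

/-- The equation of a wall, where `β` and `γ` are the parameters of ellipses and hyperbolas. -/
def Wall.eqn {k l : ℕ} (a b : ℝ) (β : Fin k → ℝ) (γ : Fin l → ℝ) : Wall k l → Plane → ℝ
  | .ellipse i, X => conicEq a b (β i) X
  | .hyperbola j, X => conicEq a b (γ j) X
  | .xAxis, X => X 1
  | .yAxis, X => X 0

/-- A normal vector of a wall at one of its points. -/
def Wall.normal {k l : ℕ} (a b : ℝ) (β : Fin k → ℝ) (γ : Fin l → ℝ) : Wall k l → Plane → Plane
  | .ellipse i, X => conicNormal a b (β i) X
  | .hyperbola j, X => conicNormal a b (γ j) X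
  | .xAxis, _ => !₂[0, 1]
  | .yAxis, _ => !₂[1, 0]

/-- `s` is a (nondegenerate, compact) arc of the wall `w`; a whole ellipse is allowed. -/
def IsArcOf {k l : ℕ} (a b : ℝ) (β : Fin k → ℝ) (γ : Fin l → ℝ) (w : Wall k l)
    (s : Set Plane) : Prop :=
  IsCompact s ∧ IsConnected s ∧ s.Nontrivial ∧ ∀ X ∈ s, w.eqn a b β γ X = 0

/-- `D` is a bounded domain whose boundary is a union of finitely many arcs of the ellipses
`C_{β i}`, of the hyperbolas `C_{γ j}` and of the coordinate axes. -/
structure IsConfocalDomain {k l : ℕ} (a b : ℝ) (β : Fin k → ℝ) (γ : Fin l → ℝ)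
    (D : Set Plane) : Prop where
  isOpen : IsOpen D
  isConnected : IsConnected D
  isBounded : Bornology.IsBounded D
  boundary : ∃ S : Set (Set Plane), S.Finite ∧
    (∀ s ∈ S, ∃ w : Wall k l, IsArcOf a b β γ w s) ∧ frontier D = ⋃₀ S

/-! ### Billiard reflection -/

/-- A particle that comes from `P` through `D` is reflected at `Q` off the single wall `w` and
leaves towards `R`: near `Q` one side of `w` (that of the sign `σ`) lies in `D`, the wall itself
does not, the particle arrives on that side, and its direction is reflected in the tangent of `w`
at `Q`. (The other side of the wall may or may not belong to `D`.) -/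
def SmoothReflection {k l : ℕ} (a b : ℝ) (β : Fin k → ℝ) (γ : Fin l → ℝ) (D : Set Plane)
    (P Q R : Plane) (w : Wall k l) : Prop :=
  w.eqn a b β γ Q = 0 ∧
  (∃ σ : ℝ, (σ = 1 ∨ σ = -1) ∧
    (∀ᶠ X in 𝓝 Q, 0 < σ * w.eqn a b β γ X → X ∈ D) ∧
    (∀ᶠ X in 𝓝 Q, w.eqn a b β γ X = 0 → X ∉ D) ∧
    (∀ᶠ t in 𝓝[>] (0 : ℝ), 0 < σ * w.eqn a b β γ (AffineMap.lineMap Q P t))) ∧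
  SameRay ℝ (R - Q) ((ℝ ∙ w.normal a b β γ Q)ᗮ.reflection (Q - P))

/-- A particle that comes from `P` through `D` is reflected at a vertex `Q` of the boundary where
the walls `w` and `w'` form a convex right angle (seen from the particle), and leaves towards `R`:
near `Q` the open sector of the signs `σ`, `σ'` lies in `D`, the sides of the sector do not, the
particle arrives in this sector, and it goes back in the direction it came from. -/
def CornerReflection {k l : ℕ} (a b : ℝ) (β : Fin k → ℝ) (γ : Fin l → ℝ) (D : Set Plane)
    (P Q R : Plane) (w w' : Wall k l) : Prop :=
  w ≠ w' ∧ w.eqn a b β γ Q = 0 ∧ w'.eqn a b β γ Q = 0 ∧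
  (∃ σ σ' : ℝ, (σ = 1 ∨ σ = -1) ∧ (σ' = 1 ∨ σ' = -1) ∧
    (∀ᶠ X in 𝓝 Q, 0 < σ * w.eqn a b β γ X → 0 < σ' * w'.eqn a b β γ X → X ∈ D) ∧
    (∀ᶠ X in 𝓝 Q, w.eqn a b β γ X = 0 → 0 ≤ σ' * w'.eqn a b β γ X → X ∉ D) ∧
    (∀ᶠ X in 𝓝 Q, w'.eqn a b β γ X = 0 → 0 ≤ σ * w.eqn a b β γ X → X ∉ D) ∧
    (∀ᶠ t in 𝓝[>] (0 : ℝ), 0 < σ * w.eqn a b β γ (AffineMap.lineMap Q P t) ∧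
      0 < σ' * w'.eqn a b β γ (AffineMap.lineMap Q P t))) ∧
  SameRay ℝ (R - Q) (P - Q)

/-- The reflection `P → Q → R` involves the wall `w`. A reflection at a right angle counts as one
bounce off each of its two walls. -/
def ReflectsOff {k l : ℕ} (a b : ℝ) (β : Fin k → ℝ) (γ : Fin l → ℝ) (D : Set Plane)
    (P Q R : Plane) (w : Wall k l) : Prop :=
  SmoothReflection a b β γ D P Q R w ∨
    ∃ w' : Wall k l, CornerReflection a b β γ D P Q R w w' ∨
      CornerReflection a b β γ D P Q R w' w

/-! ### Closed trajectories -/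

/-- `A` is the sequence of vertices of a billiard trajectory in `D` which becomes closed (as a
trajectory: position and direction) after `N` vertices. Trajectories never meet a vertex of the
boundary at which the reflection is undefined. -/
structure IsClosedTrajectory {k l : ℕ} (a b : ℝ) (β : Fin k → ℝ) (γ : Fin l → ℝ)
    (D : Set Plane) (A : ℤ → Plane) (N : ℕ) : Prop where
  pos : 0 < N
  periodic : ∀ m : ℤ, A (m + N) = A m
  ne : ∀ m : ℤ, A m ≠ A (m + 1)
  segment_subset : ∀ m : ℤ, openSegment ℝ (A m) (A (m + 1)) ⊆ D
  reflection : ∀ m : ℤ, ∃ w : Wall k l, ReflectsOff a b β γ D (A (m - 1)) (A m) (A (m + 1)) w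

/-- `C_α` is the caustic: it touches every line that contains a segment of the trajectory. -/
def IsCaustic (a b α : ℝ) (A : ℤ → Plane) : Prop :=
  ∀ m : ℤ, IsTangentLine a b α (A m) (A (m + 1))

/-- The trajectory as a path; the `m`-th segment is run through in the time interval
`[m, m + 1]`. -/
def path (A : ℤ → Plane) (t : ℝ) : Plane :=
  AffineMap.lineMap (A ⌊t⌋) (A (⌊t⌋ + 1)) (Int.fract t)

/-- The coordinate that is constant on a wall of the given kind: `λ₁` for ellipses, and `λ₂` for
hyperbolas and for the axes (outside the segment between the foci). -/
def Wall.coord {k l : ℕ} (a b : ℝ) : Wall k l → Plane → ℝ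
  | .ellipse _ => lam1 a b
  | .hyperbola _ => lam2 a b
  | .xAxis => lam2 a b
  | .yAxis => lam2 a b

/-- Number of reflections from inside off `w` in one period: those where the corresponding
elliptic coordinate has a local minimum along the trajectory. -/
def insideCount {k l : ℕ} (a b : ℝ) (β : Fin k → ℝ) (γ : Fin l → ℝ) (D : Set Plane)
    (A : ℤ → Plane) (N : ℕ) (w : Wall k l) : ℕ :=
  Set.ncard {m : ℤ | 0 ≤ m ∧ m < N ∧ ReflectsOff a b β γ D (A (m - 1)) (A m) (A (m + 1)) w ∧
    IsLocalMin (fun t => w.coord a b (path A t)) (m : ℝ)}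

/-- Number of reflections from outside off `w` in one period: those where the corresponding
elliptic coordinate has a local maximum along the trajectory. -/
def outsideCount {k l : ℕ} (a b : ℝ) (β : Fin k → ℝ) (γ : Fin l → ℝ) (D : Set Plane)
    (A : ℤ → Plane) (N : ℕ) (w : Wall k l) : ℕ :=
  Set.ncard {m : ℤ | 0 ≤ m ∧ m < N ∧ ReflectsOff a b β γ D (A (m - 1)) (A m) (A (m + 1)) w ∧
    IsLocalMax (fun t => w.coord a b (path A t)) (m : ℝ)}

/-- Number of times in one period at which the particle is on the `x`-axis, that is, the number of
intersections with this axis together with the reflections off its segments. -/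
def xAxisCount (A : ℤ → Plane) (N : ℕ) : ℕ :=
  Set.ncard {t : ℝ | 0 ≤ t ∧ t < N ∧ path A t 1 = 0}

/-- The same for the `y`-axis. -/
def yAxisCount (A : ℤ → Plane) (N : ℕ) : ℕ :=
  Set.ncard {t : ℝ | 0 ≤ t ∧ t < N ∧ path A t 0 = 0}

/-! ### The elliptic curve and its Abel-Jacobi map -/

/-- The polynomial `𝒫(t) = (a - t) (b - t) (α - t)`. -/
def cubic (a b α : ℝ) (t : ℂ) : ℂ := (a - t) * (b - t) * (α - t)

/-- The (affine part of the) elliptic curve `s² = 𝒫(t)`; points are pairs `(t, s)`. -/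
def curve (a b α : ℝ) : Set (ℂ × ℂ) := {p | p.2 ^ 2 = cubic a b α p.1}

/-- `IntegralAlong a b α P Q z`: there is a piecewise `C¹` path on the curve from `P` to `Q` along
which the integral of the holomorphic differential `dt / s` is `z`.

On a `C¹` arc `u ↦ (t u, s u)`, `0 ≤ u ≤ 1`, the pulled back form is `w u du`, where
`t' = w s` and, since `dt / s = 2 ds / 𝒫'(t)`, also `s' = w 𝒫'(t) / 2`; as `s` and `𝒫'(t)` have
no common zero on the curve, these equations determine `w`, also at the points with `s = 0`. -/
inductive IntegralAlong (a b α : ℝ) : ℂ × ℂ → ℂ × ℂ → ℂ → Prop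
  | arc (t s w : ℝ → ℂ) (hw : ContinuousOn w (Set.Icc 0 1))
      (hcurve : ∀ u ∈ Set.Icc (0 : ℝ) 1, (t u, s u) ∈ curve a b α)
      (ht : ∀ u ∈ Set.Icc (0 : ℝ) 1, HasDerivWithinAt t (w u * s u) (Set.Icc 0 1) u)
      (hs : ∀ u ∈ Set.Icc (0 : ℝ) 1,
        HasDerivWithinAt s (w u * (deriv (cubic a b α) (t u) / 2)) (Set.Icc 0 1) u) :
      IntegralAlong a b α (t 0, s 0) (t 1, s 1) (∫ u in (0 : ℝ)..1, w u)
  | trans {P Q R : ℂ × ℂ} {z z' : ℂ} :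
      IntegralAlong a b α P Q z → IntegralAlong a b α Q R z' → IntegralAlong a b α P R (z + z')

/-- The group of periods of `dt / s`. -/
def periods (a b α : ℝ) : AddSubgroup ℂ :=
  AddSubgroup.closure {z | ∃ P, IntegralAlong a b α P P z}

open Classical in
/-- The Abel-Jacobi map with base point `P₀`: the integral of `dt / s` from `P₀` to `P`, modulo
periods (which makes the choice of the path irrelevant). The curve being path connected, the
second branch does not occur for points on the curve. -/
def abelJacobi (a b α : ℝ) (P₀ P : ℂ × ℂ) : ℂ ⧸ periods a b α :=
  if h : ∃ z, IntegralAlong a b α P₀ P z then QuotientAddGroup.mk h.choose else 0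

/-- The branch `√(a - δ) √(b - δ) √(α - δ)` (principal complex square roots) of `√𝒫(δ)`. For
`α < b < a` it is the nonnegative root of `𝒫(δ)` for `δ ≤ α` and its analytic continuation off the
cuts, which is the nonpositive root, for `b ≤ δ ≤ a`. -/
def sqrtCubic (a b α δ : ℝ) : ℂ :=
  Complex.sqrt ((a - δ : ℝ) : ℂ) * Complex.sqrt ((b - δ : ℝ) : ℂ) *
    Complex.sqrt ((α - δ : ℝ) : ℂ)

/-- The point `P_δ = (δ, √𝒫(δ))`. -/
def curvePoint (a b α δ : ℝ) : ℂ × ℂ := (δ, sqrtCubic a b α δ)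

end ConfocalBilliard

end

/-!
Write `p = a - α`, `q = b - α`. Outside the caustic a point of the plane has elliptic coordinates
`λ₁ = α - ξ²` and `λ₂ = b cos² ϑ + a sin² ϑ`, that is, `x = √(p + ξ²) cos ϑ` and
`y = √(q + ξ²) sin ϑ`. Along a tangent of the caustic, run through in a suitable sense, both `ξ` and
`ϑ` increase, and `dϑ / √(λ₂ - α) = dξ / (√(p + ξ²) √(q + ξ²))`; the sign of `ξ` tells whether the
point of contact lies ahead or behind (`exists_tangent_flow`, `exists_isTangentLift`). For a line
that turns clockwise about the caustic the same holds in its mirror image in the `x`-axis, where `ϑ`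
is replaced by `-ϑ`.

The billiard then takes a simple form. A reflection off an ellipse changes `ξ` to `-ξ` and leaves
`ϑ`; a reflection off a hyperbola or an axis leaves `ξ` and changes the sense of rotation, hence
`ϑ` to `-ϑ`; a right angle does both. So over a period the increments of
`radialInt = ∫ dξ / (√(p + ξ²) √(q + ξ²))` along the sides add up to the jumps at the reflections
off ellipses (`radial_jump`), where inside and outside are told apart by the sign of `ξ` on arrival.
The increments of `angularInt = ∫ dϑ / √(λ₂ - α)` have the same sum. Here a multiple of the period
`π` is split off, which is counted by the crossings of the `x`-axis; what remains is a `π`-periodic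
function of `ϑ` and has jumps at the reflections off hyperbolas only (`angular_jump`). Comparing the
numbers of crossings of the two axes in the same way gives the second equation. The result is
`closing_conditions`, two equations between real numbers that hold exactly, not only modulo periods.

On the elliptic curve `2 radialInt` and `2 angularInt` are, up to sign, the integrals of `dt / s`
along real arcs, from `P_α` to `P_β` (`integralAlong_radial`) and from `P_a` to `P_γ` and `P_b`
(`integralAlong_angular`). As the curve is path connected (`exists_integralAlong`), these are
differences of values of the Abel-Jacobi map. The first real equation gives the vanishing of
the integrals, and the second one that the value at `P_a` has the total coefficient zero.
-/

noncomputable section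

namespace ConfocalBilliard

/-! ### The elliptic integrals of the two coordinates -/

/-- Half the elliptic integral of `λ₁`: with `λ₁ = α - ξ²`, `p = a - α`, `q = b - α` one has
`dλ₁ / √𝒫(λ₁) = ∓ 2 dξ / (√(p + ξ²) √(q + ξ²))`. -/
def radialInt (p q ξ : ℝ) : ℝ := ∫ x in (0 : ℝ)..ξ, 1 / (√(p + x ^ 2) * √(q + x ^ 2))

/-- With `λ₂ = b cos² ϑ + a sin² ϑ`, `p = a - α`, `q = b - α`, this is `√(λ₂ - α)`. -/
def angularRoot (p q ϑ : ℝ) : ℝ := √(q * Real.cos ϑ ^ 2 + p * Real.sin ϑ ^ 2)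

/-- Half the elliptic integral of `λ₂`: with `λ₂ = b cos² ϑ + a sin² ϑ` one has
`dλ₂ / √𝒫(λ₂) = ± 2 dϑ / √(λ₂ - α)`. -/
def angularInt (p q ϑ : ℝ) : ℝ := ∫ x in (0 : ℝ)..ϑ, 1 / angularRoot p q x

section Integrals

variable {p q : ℝ}

lemma angularRoot_arg_pos (hp : 0 < p) (hq : 0 < q) (ϑ : ℝ) :
    0 < q * Real.cos ϑ ^ 2 + p * Real.sin ϑ ^ 2 := by
  rcases eq_or_ne (Real.cos ϑ) 0 with h | h
  · have := Real.sin_sq_add_cos_sq ϑ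
    rw [h] at this ⊢
    have h1 : Real.sin ϑ ^ 2 = 1 := by linarith
    rw [h1]; linarith
  · have : 0 < Real.cos ϑ ^ 2 := by positivity
    positivity

lemma angularRoot_pos (hp : 0 < p) (hq : 0 < q) (ϑ : ℝ) : 0 < angularRoot p q ϑ :=
  Real.sqrt_pos.2 (angularRoot_arg_pos hp hq ϑ)

lemma angularRoot_sq (hp : 0 < p) (hq : 0 < q) (ϑ : ℝ) :
    angularRoot p q ϑ ^ 2 = q * Real.cos ϑ ^ 2 + p * Real.sin ϑ ^ 2 :=
  Real.sq_sqrt (angularRoot_arg_pos hp hq ϑ).le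

lemma continuous_angularRoot : Continuous (angularRoot p q) := by
  unfold angularRoot; fun_prop

lemma continuous_inv_angularRoot (hp : 0 < p) (hq : 0 < q) :
    Continuous fun x => 1 / angularRoot p q x :=
  continuous_const.div continuous_angularRoot fun x => (angularRoot_pos hp hq x).ne'

lemma radical_pos (hp : 0 < p) (x : ℝ) : 0 < √(p + x ^ 2) :=
  Real.sqrt_pos.2 (by positivity)

lemma radical_sq (hp : 0 < p) (x : ℝ) : √(p + x ^ 2) ^ 2 = p + x ^ 2 :=
  Real.sq_sqrt (by positivity)

lemma hasDerivAt_radical (hp : 0 < p) (x : ℝ) :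
    HasDerivAt (fun x : ℝ => √(p + x ^ 2)) (x / √(p + x ^ 2)) x := by
  have h : HasDerivAt (fun x : ℝ => p + x ^ 2) (2 * x) x := by
    simpa using (hasDerivAt_pow 2 x).const_add p
  convert h.sqrt (by positivity) using 1
  field_simp

lemma hasDerivAt_angularRoot (hp : 0 < p) (hq : 0 < q) (x : ℝ) :
    HasDerivAt (angularRoot p q)
      ((p - q) * Real.sin x * Real.cos x / angularRoot p q x) x := by
  have h : HasDerivAt (fun x : ℝ => q * Real.cos x ^ 2 + p * Real.sin x ^ 2)
      (2 * (p - q) * Real.sin x * Real.cos x) x := by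
    refine ((((Real.hasDerivAt_cos x).pow 2).const_mul q).add
      (((Real.hasDerivAt_sin x).pow 2).const_mul p)).congr_deriv ?_
    push_cast
    ring
  refine (h.sqrt (angularRoot_arg_pos hp hq x).ne').congr_deriv ?_
  change _ = (p - q) * Real.sin x * Real.cos x /
    √(q * Real.cos x ^ 2 + p * Real.sin x ^ 2)
  field_simp

lemma continuous_radial_integrand (hp : 0 < p) (hq : 0 < q) :
    Continuous fun x : ℝ => 1 / (√(p + x ^ 2) * √(q + x ^ 2)) := by
  refine continuous_const.div (by fun_prop) fun x => ?_
  have := radical_pos hp x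
  have := radical_pos hq x
  positivity

lemma hasDerivAt_radialInt (hp : 0 < p) (hq : 0 < q) (ξ : ℝ) :
    HasDerivAt (radialInt p q) (1 / (√(p + ξ ^ 2) * √(q + ξ ^ 2))) ξ :=
  (continuous_radial_integrand hp hq).integral_hasStrictDerivAt 0 ξ |>.hasDerivAt

lemma hasDerivAt_angularInt (hp : 0 < p) (hq : 0 < q) (ϑ : ℝ) :
    HasDerivAt (angularInt p q) (1 / angularRoot p q ϑ) ϑ :=
  (continuous_inv_angularRoot hp hq).integral_hasStrictDerivAt 0 ϑ |>.hasDerivAt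

lemma strictMono_radialInt (hp : 0 < p) (hq : 0 < q) : StrictMono (radialInt p q) :=
  strictMono_of_hasDerivAt_pos (hasDerivAt_radialInt hp hq) fun x => by
    have := radical_pos hp x
    have := radical_pos hq x
    positivity

lemma strictMono_angularInt (hp : 0 < p) (hq : 0 < q) : StrictMono (angularInt p q) :=
  strictMono_of_hasDerivAt_pos (hasDerivAt_angularInt hp hq) fun x => by
    have := angularRoot_pos hp hq x
    positivity

lemma radialInt_neg (ξ : ℝ) : radialInt p q (-ξ) = -radialInt p q ξ := by
  have h := intervalIntegral.integral_comp_neg (a := 0) (b := ξ)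
    (fun x : ℝ => 1 / (√(p + x ^ 2) * √(q + x ^ 2)))
  simp only [neg_sq, neg_zero] at h
  rw [radialInt, intervalIntegral.integral_symm, ← h, radialInt]

lemma angularRoot_neg (ϑ : ℝ) : angularRoot p q (-ϑ) = angularRoot p q ϑ := by
  simp [angularRoot]

lemma angularRoot_pi_sub (ϑ : ℝ) : angularRoot p q (Real.pi - ϑ) = angularRoot p q ϑ := by
  simp [angularRoot]

lemma angularRoot_periodic : Function.Periodic (fun x => 1 / angularRoot p q x) Real.pi :=
  fun x => by simp [angularRoot, Real.cos_add_pi, Real.sin_add_pi]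

lemma angularInt_neg (ϑ : ℝ) : angularInt p q (-ϑ) = -angularInt p q ϑ := by
  have h := intervalIntegral.integral_comp_neg (a := 0) (b := ϑ)
    (fun x : ℝ => 1 / angularRoot p q x)
  simp only [angularRoot_neg, neg_zero] at h
  rw [angularInt, intervalIntegral.integral_symm, ← h, angularInt]

lemma angularInt_zero : angularInt p q 0 = 0 := by simp [angularInt]

lemma radialInt_zero : radialInt p q 0 = 0 := by simp [radialInt]

lemma angularInt_pi (hp : 0 < p) (hq : 0 < q) :
    angularInt p q Real.pi = 2 * angularInt p q (Real.pi / 2) := by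
  have hi := fun x y => (continuous_inv_angularRoot hp hq).intervalIntegrable (μ :=
    MeasureTheory.volume) x y
  have h := intervalIntegral.integral_comp_sub_left (a := 0) (b := Real.pi / 2)
    (fun x : ℝ => 1 / angularRoot p q x) Real.pi
  simp only [angularRoot_pi_sub, sub_zero, sub_half] at h
  rw [angularInt, ← intervalIntegral.integral_add_adjacent_intervals (hi 0 (Real.pi / 2))
    (hi _ _), ← h, angularInt]
  ring

lemma angularInt_add_int_mul_pi (hp : 0 < p) (hq : 0 < q) (ϑ : ℝ) (n : ℤ) :
    angularInt p q (ϑ + n * Real.pi) =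
      angularInt p q ϑ + 2 * n * angularInt p q (Real.pi / 2) := by
  have hi := fun x y => (continuous_inv_angularRoot hp hq).intervalIntegrable (μ :=
    MeasureTheory.volume) x y
  have h := (angularRoot_periodic (p := p) (q := q)).intervalIntegral_add_zsmul_eq n ϑ
    (fun x y => hi x y)
  have h0 : ∫ x in ϑ..ϑ + Real.pi, 1 / angularRoot p q x = angularInt p q Real.pi := by
    rw [angularRoot_periodic.intervalIntegral_add_eq ϑ 0, zero_add, angularInt]
  rw [h0, angularInt_pi hp hq, zsmul_eq_mul, zsmul_eq_mul] at h
  have h2 : angularInt p q (ϑ + n * Real.pi) = angularInt p q ϑ +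
      ∫ x in ϑ..(ϑ + n * Real.pi), 1 / angularRoot p q x :=
    (intervalIntegral.integral_add_adjacent_intervals (hi 0 ϑ) (hi _ _)).symm
  rw [h2, h]
  ring

lemma surjective_angularInt (hp : 0 < p) (hq : 0 < q) :
    Function.Surjective (angularInt p q) := by
  have htop : Filter.Tendsto (angularInt p q) Filter.atTop Filter.atTop :=
    angularRoot_periodic.tendsto_atTop_intervalIntegral_of_pos'
      ((continuous_inv_angularRoot hp hq).intervalIntegrable _ _)
      (fun x => one_div_pos.2 (angularRoot_pos hp hq x)) Real.pi_pos
  have hcont : Continuous (angularInt p q) :=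
    continuous_iff_continuousAt.2 fun x => (hasDerivAt_angularInt hp hq x).continuousAt
  refine hcont.surjective htop ?_
  have h2 : angularInt p q = fun x => -angularInt p q (-x) := by
    funext x; rw [angularInt_neg, neg_neg]
  rw [h2]
  exact Filter.tendsto_neg_atTop_atBot.comp (htop.comp Filter.tendsto_neg_atBot_atTop)

end Integrals

/-! ### Tangents of the caustic as a flow -/

section Flow

variable {p q : ℝ}

/-- A function with everywhere vanishing derivative takes everywhere its value at `0`. -/
lemma eq_apply_zero_of_hasDerivAt_zero {F : ℝ → ℝ} (h : ∀ x, HasDerivAt F 0 x) (x : ℝ) :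
    F x = F 0 :=
  is_const_of_deriv_eq_zero (fun y => (h y).differentiableAt) (fun y => (h y).deriv) x 0

/-- The equation `dϑ / √(λ₂ - α) = dξ / (√(p + ξ²) √(q + ξ²))` has a global increasing solution
through `(0, φ)`. -/
lemma exists_angular_flow (hp : 0 < p) (hq : 0 < q) (φ : ℝ) :
    ∃ Θ : ℝ → ℝ, Θ 0 = φ ∧ StrictMono Θ ∧
      (∀ ξ, angularInt p q (Θ ξ) = angularInt p q φ + radialInt p q ξ) ∧
      ∀ ξ, HasDerivAt Θ (angularRoot p q (Θ ξ) / (√(p + ξ ^ 2) * √(q + ξ ^ 2))) ξ := by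
  let e := (strictMono_angularInt hp hq).orderIsoOfSurjective _ (surjective_angularInt hp hq)
  have he : ∀ y, angularInt p q (e.symm y) = y := fun y => e.apply_symm_apply y
  have hD : ∀ y, HasDerivAt e.symm (angularRoot p q (e.symm y)) y := fun y => by
    have := HasDerivAt.of_local_left_inverse (f := angularInt p q) (g := e.symm) (a := y)
      e.symm.continuous.continuousAt (hasDerivAt_angularInt hp hq _)
      (one_div_pos.2 (angularRoot_pos hp hq _)).ne' (Filter.Eventually.of_forall he)
    simpa using this
  refine ⟨fun ξ => e.symm (angularInt p q φ + radialInt p q ξ), ?_, ?_, fun ξ => he _, fun ξ => ?_⟩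
  · simp only [radialInt_zero, add_zero]
    exact e.symm_apply_apply φ
  · exact e.symm.strictMono.comp ((strictMono_radialInt hp hq).const_add _)
  · have h := (hD (angularInt p q φ + radialInt p q ξ)).comp ξ
      ((hasDerivAt_radialInt hp hq ξ).const_add (angularInt p q φ))
    refine h.congr_deriv ?_
    ring

/-- Along the flow of `exists_angular_flow` the point with elliptic coordinates `(ξ, ϑ)` runs on
the line that touches the caustic at the point of eccentric angle `φ`. The reason is that the
velocity, divided by its length `ρ² + ξ²`, has derivative zero. -/
theorem exists_tangent_flow (hq : 0 < q) (hqp : q < p) (φ : ℝ) :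
    ∃ Θ r κ : ℝ → ℝ, StrictMono Θ ∧ Continuous Θ ∧ StrictMono r ∧ Continuous r ∧
      Function.Surjective r ∧
      (∀ ξ, angularInt p q (Θ ξ) = angularInt p q φ + radialInt p q ξ) ∧
      ∀ ξ, 0 < κ ξ ∧
        √(p + ξ ^ 2) * Real.cos (Θ ξ) = √p * Real.cos φ + r ξ * (-√p * Real.sin φ) ∧
        √(q + ξ ^ 2) * Real.sin (Θ ξ) = √q * Real.sin φ + r ξ * (√q * Real.cos φ) ∧
        ξ * √(q + ξ ^ 2) * Real.cos (Θ ξ) -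
          angularRoot p q (Θ ξ) * √(p + ξ ^ 2) * Real.sin (Θ ξ) = κ ξ * (-√p * Real.sin φ) ∧
        ξ * √(p + ξ ^ 2) * Real.sin (Θ ξ) +
          angularRoot p q (Θ ξ) * √(q + ξ ^ 2) * Real.cos (Θ ξ) = κ ξ * (√q * Real.cos φ) := by
  have hp : 0 < p := hq.trans hqp
  obtain ⟨Θ, hΘ0, hΘm, hΘi, hΘ'⟩ := exists_angular_flow hp hq φ
  have hΘc : Continuous Θ := continuous_iff_continuousAt.2 fun ξ => (hΘ' ξ).continuousAt
  have hρφ := angularRoot_pos hp hq φ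
  -- derivatives along the flow
  have hA := fun ξ => hasDerivAt_radical hp ξ
  have hB := fun ξ => hasDerivAt_radical hq ξ
  have hC := fun ξ => (hΘ' ξ).cos
  have hS := fun ξ => (hΘ' ξ).sin
  have hR : ∀ ξ, HasDerivAt (fun ξ => angularRoot p q (Θ ξ))
      ((p - q) * Real.sin (Θ ξ) * Real.cos (Θ ξ) / (√(p + ξ ^ 2) * √(q + ξ ^ 2))) ξ := by
    intro ξ
    have := (angularRoot_pos hp hq (Θ ξ)).ne'
    refine ((hasDerivAt_angularRoot hp hq (Θ ξ)).comp ξ (hΘ' ξ)).congr_deriv ?_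
    field_simp
  have hN : ∀ ξ, HasDerivAt (fun ξ => angularRoot p q (Θ ξ) ^ 2 + ξ ^ 2)
      (2 * (angularRoot p q (Θ ξ) * ((p - q) * Real.sin (Θ ξ) * Real.cos (Θ ξ)) +
        ξ * √(p + ξ ^ 2) * √(q + ξ ^ 2)) / (√(p + ξ ^ 2) * √(q + ξ ^ 2))) ξ := by
    intro ξ
    have := (radical_pos hp ξ).ne'
    have := (radical_pos hq ξ).ne'
    refine (((hR ξ).pow 2).add (hasDerivAt_pow 2 ξ)).congr_deriv ?_
    field_simp
    push_cast
    ring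
  have hN0 : ∀ ξ, 0 < angularRoot p q (Θ ξ) ^ 2 + ξ ^ 2 := fun ξ => by
    have := angularRoot_pos hp hq (Θ ξ)
    positivity
  have hVx : ∀ ξ, HasDerivAt (fun ξ => ξ * √(q + ξ ^ 2) * Real.cos (Θ ξ) -
      angularRoot p q (Θ ξ) * √(p + ξ ^ 2) * Real.sin (Θ ξ))
      (2 * (√(p + ξ ^ 2) * Real.cos (Θ ξ) * (ξ ^ 2 - (p - q) * Real.sin (Θ ξ) ^ 2) -
        angularRoot p q (Θ ξ) * ξ * √(q + ξ ^ 2) * Real.sin (Θ ξ)) /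
        (√(p + ξ ^ 2) * √(q + ξ ^ 2))) ξ := by
    intro ξ
    refine ((((hasDerivAt_id' ξ).mul (hB ξ)).mul (hC ξ)).sub
      (((hR ξ).mul (hA ξ)).mul (hS ξ))).congr_deriv ?_
    have h1 := radical_sq hp ξ
    have h2 := radical_sq hq ξ
    have h3 := angularRoot_sq hp hq (Θ ξ)
    have h4 := Real.sin_sq_add_cos_sq (Θ ξ)
    have h5 := (radical_pos hp ξ).ne'
    have h6 := (radical_pos hq ξ).ne'
    simp only [Pi.mul_apply]
    generalize √(p + ξ ^ 2) = A at *
    generalize √(q + ξ ^ 2) = B at *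
    generalize angularRoot p q (Θ ξ) = ρ at *
    generalize Real.sin (Θ ξ) = s at *
    generalize Real.cos (Θ ξ) = c at *
    field_simp
    grind
  have hVy : ∀ ξ, HasDerivAt (fun ξ => ξ * √(p + ξ ^ 2) * Real.sin (Θ ξ) +
      angularRoot p q (Θ ξ) * √(q + ξ ^ 2) * Real.cos (Θ ξ))
      (2 * (√(q + ξ ^ 2) * Real.sin (Θ ξ) * (ξ ^ 2 + (p - q) * Real.cos (Θ ξ) ^ 2) +
        angularRoot p q (Θ ξ) * ξ * √(p + ξ ^ 2) * Real.cos (Θ ξ)) /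
        (√(p + ξ ^ 2) * √(q + ξ ^ 2))) ξ := by
    intro ξ
    refine ((((hasDerivAt_id' ξ).mul (hA ξ)).mul (hS ξ)).add
      (((hR ξ).mul (hB ξ)).mul (hC ξ))).congr_deriv ?_
    have h1 := radical_sq hp ξ
    have h2 := radical_sq hq ξ
    have h3 := angularRoot_sq hp hq (Θ ξ)
    have h4 := Real.sin_sq_add_cos_sq (Θ ξ)
    have h5 := (radical_pos hp ξ).ne'
    have h6 := (radical_pos hq ξ).ne'
    simp only [Pi.mul_apply]
    generalize √(p + ξ ^ 2) = A at *
    generalize √(q + ξ ^ 2) = B at *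
    generalize angularRoot p q (Θ ξ) = ρ at *
    generalize Real.sin (Θ ξ) = s at *
    generalize Real.cos (Θ ξ) = c at *
    field_simp
    grind
  -- the velocity, divided by its length, is constant
  have hWx : ∀ ξ, (ξ * √(q + ξ ^ 2) * Real.cos (Θ ξ) -
      angularRoot p q (Θ ξ) * √(p + ξ ^ 2) * Real.sin (Θ ξ)) /
        (angularRoot p q (Θ ξ) ^ 2 + ξ ^ 2) = -√p * Real.sin φ / angularRoot p q φ := by
    intro ξ
    rw [eq_apply_zero_of_hasDerivAt_zero (F := fun ξ => (ξ * √(q + ξ ^ 2) * Real.cos (Θ ξ) -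
      angularRoot p q (Θ ξ) * √(p + ξ ^ 2) * Real.sin (Θ ξ)) /
        (angularRoot p q (Θ ξ) ^ 2 + ξ ^ 2)) (fun x => ?_) ξ]
    · simp only [hΘ0]
      field_simp
      simp
      ring
    · refine ((hVx x).div (hN x) (hN0 x).ne').congr_deriv ?_
      have h1 := radical_sq hp x
      have h2 := radical_sq hq x
      have h3 := angularRoot_sq hp hq (Θ x)
      have h4 := Real.sin_sq_add_cos_sq (Θ x)
      have h5 := (radical_pos hp x).ne'
      have h6 := (radical_pos hq x).ne'
      generalize √(p + x ^ 2) = A at *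
      generalize √(q + x ^ 2) = B at *
      generalize angularRoot p q (Θ x) = ρ at *
      generalize Real.sin (Θ x) = s at *
      generalize Real.cos (Θ x) = c at *
      rw [div_eq_zero_iff]; left
      field_simp
      grind
  have hWy : ∀ ξ, (ξ * √(p + ξ ^ 2) * Real.sin (Θ ξ) +
      angularRoot p q (Θ ξ) * √(q + ξ ^ 2) * Real.cos (Θ ξ)) /
        (angularRoot p q (Θ ξ) ^ 2 + ξ ^ 2) = √q * Real.cos φ / angularRoot p q φ := by
    intro ξ
    rw [eq_apply_zero_of_hasDerivAt_zero (F := fun ξ => (ξ * √(p + ξ ^ 2) * Real.sin (Θ ξ) +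
      angularRoot p q (Θ ξ) * √(q + ξ ^ 2) * Real.cos (Θ ξ)) /
        (angularRoot p q (Θ ξ) ^ 2 + ξ ^ 2)) (fun x => ?_) ξ]
    · simp only [hΘ0]
      field_simp
      simp
      ring
    · refine ((hVy x).div (hN x) (hN0 x).ne').congr_deriv ?_
      have h1 := radical_sq hp x
      have h2 := radical_sq hq x
      have h3 := angularRoot_sq hp hq (Θ x)
      have h4 := Real.sin_sq_add_cos_sq (Θ x)
      have h5 := (radical_pos hp x).ne'
      have h6 := (radical_pos hq x).ne'
      generalize √(p + x ^ 2) = A at *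
      generalize √(q + x ^ 2) = B at *
      generalize angularRoot p q (Θ x) = ρ at *
      generalize Real.sin (Θ x) = s at *
      generalize Real.cos (Θ x) = c at *
      rw [div_eq_zero_iff]; left
      field_simp
      grind
  have hκx := fun ξ => (div_eq_iff (hN0 ξ).ne').1 (hWx ξ)
  have hκy := fun ξ => (div_eq_iff (hN0 ξ).ne').1 (hWy ξ)
  -- the position on the tangent line
  set k : ℝ → ℝ := fun x => (angularRoot p q (Θ x) ^ 2 + x ^ 2) /
    (angularRoot p q φ * (√(p + x ^ 2) * √(q + x ^ 2))) with hk
  have hkc : Continuous k := by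
    refine Continuous.div ?_ (by fun_prop) fun x => ?_
    · have := (continuous_angularRoot (p := p) (q := q)).comp hΘc
      exact (this.pow 2).add (continuous_pow 2)
    · have := radical_pos hp x
      have := radical_pos hq x
      positivity
  have hr' : ∀ ξ, HasDerivAt (fun ξ => ∫ x in (0 : ℝ)..ξ, k x) (k ξ) ξ := fun ξ =>
    (hkc.integral_hasStrictDerivAt 0 ξ).hasDerivAt
  have hr0 : ∫ x in (0 : ℝ)..0, k x = 0 := by simp
  have hkpos : ∀ x, q / ((p + q) * angularRoot p q φ) ≤ k x := by
    intro x
    have h1 := radical_sq hp x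
    have h2 := radical_sq hq x
    have h3 := angularRoot_sq hp hq (Θ x)
    have h4 := Real.sin_sq_add_cos_sq (Θ x)
    have h5 := radical_pos hp x
    have h6 := radical_pos hq x
    have h7 : q ≤ angularRoot p q (Θ x) ^ 2 := by
      nlinarith [sq_nonneg (Real.sin (Θ x))]
    -- the inequality between the arithmetic and the geometric mean
    have h8 : √(p + x ^ 2) * √(q + x ^ 2) ≤ p + q + x ^ 2 := by
      nlinarith [sq_nonneg (√(p + x ^ 2) - √(q + x ^ 2))]
    simp only [hk]
    rw [div_le_div_iff₀ (by positivity) (by positivity)]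
    have h9 : q * (√(p + x ^ 2) * √(q + x ^ 2)) ≤
        (angularRoot p q (Θ x) ^ 2 + x ^ 2) * (p + q) := by
      nlinarith [sq_nonneg x, mul_nonneg hp.le (sq_nonneg x)]
    nlinarith
  have hkpos' : ∀ x, 0 < k x := fun x => lt_of_lt_of_le (by positivity) (hkpos x)
  have hrm := strictMono_of_hasDerivAt_pos hr' hkpos'
  have hrc : Continuous fun ξ => ∫ x in (0 : ℝ)..ξ, k x :=
    continuous_iff_continuousAt.2 fun ξ => (hr' ξ).continuousAt
  -- a positive lower bound of the derivative makes `r` surjective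
  have hlin : Monotone fun ξ => (∫ x in (0 : ℝ)..ξ, k x) -
      q / ((p + q) * angularRoot p q φ) * ξ := by
    refine monotone_of_hasDerivAt_nonneg
      (fun ξ => (hr' ξ).sub ((hasDerivAt_id' ξ).const_mul _)) fun ξ => ?_
    have := hkpos ξ
    simp only [Pi.zero_apply, mul_one]
    linarith
  have hc0 : 0 < q / ((p + q) * angularRoot p q φ) := by positivity
  refine ⟨Θ, fun ξ => ∫ x in (0 : ℝ)..ξ, k x,
    fun ξ => (angularRoot p q (Θ ξ) ^ 2 + ξ ^ 2) / angularRoot p q φ, hΘm, hΘc, hrm, hrc,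
    hrc.surjective ?_ ?_, hΘi, fun ξ => ⟨div_pos (hN0 ξ) hρφ, ?_, ?_, ?_, ?_⟩⟩
  · refine Filter.tendsto_atTop_mono' _ ?_ (Filter.tendsto_id.const_mul_atTop hc0)
    filter_upwards [Filter.eventually_ge_atTop 0] with x hx
    have := hlin hx
    simp only [hr0, id] at this ⊢
    linarith
  · refine Filter.tendsto_atBot_mono' _ ?_ (Filter.tendsto_id.const_mul_atBot hc0)
    filter_upwards [Filter.eventually_le_atBot 0] with x hx
    have := hlin hx
    simp only [hr0, id] at this ⊢
    linarith
  · have := eq_apply_zero_of_hasDerivAt_zero (F := fun ξ => √(p + ξ ^ 2) * Real.cos (Θ ξ) -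
      (∫ x in (0 : ℝ)..ξ, k x) * (-√p * Real.sin φ)) (fun x => ?_) ξ
    · simp only [hr0, hΘ0] at this
      simp at this
      linarith
    · refine (((hA x).mul (hC x)).sub ((hr' x).mul_const _)).congr_deriv ?_
      have e := hκx x
      have h1 := radical_sq hp x
      have h5 := radical_pos hp x
      have h6 := radical_pos hq x
      simp only [hk]
      generalize √(p + x ^ 2) = A at *
      generalize √(q + x ^ 2) = B at *
      field_simp at e ⊢
      linear_combination e
  · have := eq_apply_zero_of_hasDerivAt_zero (F := fun ξ => √(q + ξ ^ 2) * Real.sin (Θ ξ) -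
      (∫ x in (0 : ℝ)..ξ, k x) * (√q * Real.cos φ)) (fun x => ?_) ξ
    · simp only [hr0, hΘ0] at this
      simp at this
      linarith
    · refine (((hB x).mul (hS x)).sub ((hr' x).mul_const _)).congr_deriv ?_
      have e := hκy x
      have h5 := radical_pos hp x
      have h6 := radical_pos hq x
      simp only [hk]
      generalize √(p + x ^ 2) = A at *
      generalize √(q + x ^ 2) = B at *
      field_simp at e ⊢
      linear_combination e
  · rw [hκx]; ring
  · rw [hκy]; ring

end Flow

/-! ### Lifts of the sides -/

lemma exists_cos_sin_eq {x y : ℝ} (h : x ^ 2 + y ^ 2 = 1) :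
    ∃ φ : ℝ, x = Real.cos φ ∧ y = Real.sin φ := by
  have hz : ‖(⟨x, y⟩ : ℂ)‖ = 1 := by
    rw [Complex.norm_def, Complex.normSq_mk, Real.sqrt_eq_one]
    linarith
  have hne : (⟨x, y⟩ : ℂ) ≠ 0 := norm_pos_iff.1 (by rw [hz]; exact one_pos)
  refine ⟨Complex.arg ⟨x, y⟩, ?_, ?_⟩
  · rw [Complex.cos_arg hne, hz, div_one]
  · rw [Complex.sin_arg, hz, div_one]

/-- The signed elliptic coordinates `λ₁ = α - ξ²`, `λ₂ = b cos² ϑ + a sin² ϑ` of a point `X` moving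
with velocity `v` on a tangent of the caustic; here `p = a - α` and `q = b - α`. The sign of `ξ`
tells whether the particle approaches the caustic or leaves it, `ε` is the sense in which it turns
about the caustic, and the angle `ϑ` is measured in that sense. The velocity is a positive multiple
of the tangent vector of a curve on which `ξ` and `ϑ` increase according to
`dϑ / √(λ₂ - α) = dξ / (√(p + ξ²) √(q + ξ²))`. -/
structure IsTangentState (p q : ℝ) (X v : Plane) (ε ξ ϑ : ℝ) : Prop where
  sign : ε = 1 ∨ ε = -1
  pos_x : X 0 = √(p + ξ ^ 2) * Real.cos ϑ
  pos_y : X 1 = ε * (√(q + ξ ^ 2) * Real.sin ϑ)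
  velocity : ∃ c, 0 < c ∧
    v 0 = c * (ξ * √(q + ξ ^ 2) * Real.cos ϑ - angularRoot p q ϑ * √(p + ξ ^ 2) * Real.sin ϑ) ∧
    v 1 = ε * (c * (ξ * √(p + ξ ^ 2) * Real.sin ϑ +
      angularRoot p q ϑ * √(q + ξ ^ 2) * Real.cos ϑ))

/-- A lift of the line through `P` and `Q`, parametrised by `AffineMap.lineMap P Q`, to the
coordinates of `IsTangentState`. -/
structure IsTangentLift (p q : ℝ) (P Q : Plane) (ε : ℝ) (ξ ϑ : ℝ → ℝ) : Prop where
  strictMono_radial : StrictMono ξ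
  continuous_radial : Continuous ξ
  strictMono_angle : StrictMono ϑ
  continuous_angle : Continuous ϑ
  integral_eq : ∀ u v, angularInt p q (ϑ v) - angularInt p q (ϑ u) =
    radialInt p q (ξ v) - radialInt p q (ξ u)
  state : ∀ u, IsTangentState p q (AffineMap.lineMap P Q u) (Q - P) ε (ξ u) (ϑ u)

lemma lineMap_coord (P Q : Plane) (u : ℝ) (i : Fin 2) :
    (AffineMap.lineMap P Q u : Plane) i = P i + u * (Q - P) i := by
  simp [AffineMap.lineMap_apply]
  ring

/-- The point of contact and the direction of a tangent of the ellipse `x² / p + y² / q = 1`, in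
terms of the eccentric angle measured in the sense of the direction. -/
lemma exists_contact_angle {p q x y v w : ℝ} (hp : 0 < p) (hq : 0 < q)
    (hT : x ^ 2 / p + y ^ 2 / q = 1) (hv : x / p * v + y / q * w = 0) (hne : v ≠ 0 ∨ w ≠ 0) :
    ∃ ε c φ : ℝ, (ε = 1 ∨ ε = -1) ∧ 0 < c ∧ x = √p * Real.cos φ ∧ y = ε * (√q * Real.sin φ) ∧
      v = c * (-√p * Real.sin φ) ∧ w = ε * (c * (√q * Real.cos φ)) := by
  have hp' : 0 < √p := Real.sqrt_pos.2 hp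
  have hq' : 0 < √q := Real.sqrt_pos.2 hq
  have hp2 : √p ^ 2 = p := Real.sq_sqrt hp.le
  have hq2 : √q ^ 2 = q := Real.sq_sqrt hq.le
  obtain ⟨φ, hx, hy⟩ := exists_cos_sin_eq (x := x / √p) (y := y / √q) (by
    rw [div_pow, div_pow, hp2, hq2, hT])
  rw [div_eq_iff hp'.ne'] at hx
  rw [div_eq_iff hq'.ne'] at hy
  have h1 := Real.sin_sq_add_cos_sq φ
  generalize √p = P at *
  generalize √q = Q at *
  subst hp2 hq2 hx hy
  have hv2 : v / P * Real.cos φ + w / Q * Real.sin φ = 0 := by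
    rw [← hv]; field_simp
  set c := w / Q * Real.cos φ - v / P * Real.sin φ with hc
  have e1 : v = c * (-P * Real.sin φ) := by
    have : v / P = -(c * Real.sin φ) := by
      rw [hc]; linear_combination Real.cos φ * hv2 - v / P * h1
    rw [div_eq_iff hp'.ne'] at this
    rw [this]; ring
  have e2 : w = c * (Q * Real.cos φ) := by
    have : w / Q = c * Real.cos φ := by
      rw [hc]; linear_combination Real.sin φ * hv2 - w / Q * h1
    rw [div_eq_iff hq'.ne'] at this
    rw [this]; ring
  clear_value c
  -- a clockwise direction becomes counterclockwise in the mirror image `φ ↦ -φ`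
  rcases lt_trichotomy c 0 with h | h | h
  · refine ⟨-1, -c, -φ, Or.inr rfl, by linarith, ?_, ?_, ?_, ?_⟩ <;>
      simp [e1, e2] <;> ring
  · simp [e1, e2, h] at hne
  · refine ⟨1, c, φ, Or.inl rfl, h, ?_, ?_, ?_, ?_⟩
    · ring
    · ring
    · exact e1
    · rw [one_mul, e2]

/-- Every directed tangent of the caustic has a lift. The lift is the flow of
`exists_tangent_flow` through the point of contact, where `ξ = 0`, reparametrised by the position
on the line. -/
theorem exists_isTangentLift {a b α : ℝ} (hab : b < a) (hα : α < b) {P Q : Plane} (hPQ : P ≠ Q)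
    (h : IsTangentLine a b α P Q) :
    ∃ ε : ℝ, ∃ ξ ϑ : ℝ → ℝ, IsTangentLift (a - α) (b - α) P Q ε ξ ϑ := by
  obtain ⟨T, hT, hTm, hn⟩ := h
  obtain ⟨t₀, rfl⟩ := mem_affineSpan_pair_iff_exists_lineMap_eq.1 hTm
  have hq : 0 < b - α := by linarith
  have hqp : b - α < a - α := by linarith
  set T : Plane := AffineMap.lineMap P Q t₀ with hTdef
  have hv : T 0 / (a - α) * (Q - P) 0 + T 1 / (b - α) * (Q - P) 1 = 0 := by
    rw [← hn]
    simp [conicNormal, PiLp.inner_apply, Fin.sum_univ_two]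
    ring
  have hne : (Q - P) 0 ≠ 0 ∨ (Q - P) 1 ≠ 0 := by
    by_contra! hcon
    apply hPQ
    have : Q - P = 0 := by
      ext i; fin_cases i
      · exact hcon.1
      · exact hcon.2
    exact (sub_eq_zero.1 this).symm
  obtain ⟨ε, c, φ, hε, hc, hx, hy, hvx, hvy⟩ := exists_contact_angle (hq.trans hqp) hq
    (by rw [conicEq] at hT; linarith) hv hne
  obtain ⟨Θ, r, κ, hΘm, hΘc, hrm, hrc, hrs, hint, hfl⟩ := exists_tangent_flow hq hqp φ
  let R := hrm.orderIsoOfSurjective r hrs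
  have hR : ∀ y, r (R.symm y) = y := fun y => R.apply_symm_apply y
  have hlm : StrictMono fun u : ℝ => c * (u - t₀) := fun u v huv =>
    mul_lt_mul_of_pos_left (sub_lt_sub_right huv _) hc
  have hlc : Continuous fun u : ℝ => c * (u - t₀) := by fun_prop
  have hξm : StrictMono fun u : ℝ => R.symm (c * (u - t₀)) := R.symm.strictMono.comp hlm
  have hξc : Continuous fun u : ℝ => R.symm (c * (u - t₀)) := R.symm.continuous.comp hlc
  have hline : ∀ u i, (AffineMap.lineMap P Q u : Plane) i = T i + (u - t₀) * (Q - P) i := by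
    intro u i
    rw [hTdef, lineMap_coord, lineMap_coord]
    ring
  refine ⟨ε, fun u => R.symm (c * (u - t₀)), fun u => Θ (R.symm (c * (u - t₀))), hξm, hξc,
    hΘm.comp hξm, hΘc.comp hξc, fun u v => by rw [hint, hint]; ring, fun u => ⟨hε, ?_, ?_, ?_⟩⟩
  · obtain ⟨-, h1, -, -, -⟩ := hfl (R.symm (c * (u - t₀)))
    rw [h1, hR, hline, hx, hvx]
    ring
  · obtain ⟨-, -, h1, -, -⟩ := hfl (R.symm (c * (u - t₀)))
    rw [h1, hR, hline, hy, hvy]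
    ring
  · obtain ⟨h0, -, -, h1, h2⟩ := hfl (R.symm (c * (u - t₀)))
    refine ⟨c / κ (R.symm (c * (u - t₀))), div_pos hc h0, ?_, ?_⟩
    · rw [h1, hvx]; field_simp
    · rw [h2, hvy]; field_simp

/-! ### Position and velocity in elliptic coordinates -/

section States

variable {a b α : ℝ} {X v v' : Plane} {ε ξ ϑ ε' ξ' ϑ' : ℝ}

/-- The sum and the difference of the two elliptic coordinates. -/
lemma discriminant_eq (hb : α < b) (hab : b < a)
    (h : IsTangentState (a - α) (b - α) X v ε ξ ϑ) :
    a + b - X 0 ^ 2 - X 1 ^ 2 = (α - ξ ^ 2) + (b + (a - b) * Real.sin ϑ ^ 2) ∧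
    √((a + b - X 0 ^ 2 - X 1 ^ 2) ^ 2 - 4 * (a * b - b * X 0 ^ 2 - a * X 1 ^ 2)) =
      (b + (a - b) * Real.sin ϑ ^ 2) - (α - ξ ^ 2) := by
  have h1 : X 0 ^ 2 = (a - α + ξ ^ 2) * Real.cos ϑ ^ 2 := by
    rw [h.pos_x, mul_pow, radical_sq (by linarith)]
  have h2 : X 1 ^ 2 = (b - α + ξ ^ 2) * Real.sin ϑ ^ 2 := by
    have : ε ^ 2 = 1 := by rcases h.sign with h | h <;> simp [h]
    rw [h.pos_y, mul_pow, mul_pow, radical_sq (by linarith), this, one_mul]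
  have h3 := Real.sin_sq_add_cos_sq ϑ
  have h4 : Real.cos ϑ ^ 2 = 1 - Real.sin ϑ ^ 2 := by linarith
  rw [h1, h2, h4]
  refine ⟨by ring, ?_⟩
  rw [Real.sqrt_eq_iff_mul_self_eq_of_pos]
  · ring
  · nlinarith [sq_nonneg (Real.sin ϑ), sq_nonneg ξ]

lemma IsTangentState.lam1_eq (hb : α < b) (hab : b < a)
    (h : IsTangentState (a - α) (b - α) X v ε ξ ϑ) : lam1 a b X = α - ξ ^ 2 := by
  obtain ⟨h1, h2⟩ := discriminant_eq hb hab h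
  rw [lam1, h2, h1]
  ring

lemma IsTangentState.lam2_eq (hb : α < b) (hab : b < a)
    (h : IsTangentState (a - α) (b - α) X v ε ξ ϑ) :
    lam2 a b X = b + (a - b) * Real.sin ϑ ^ 2 := by
  obtain ⟨h1, h2⟩ := discriminant_eq hb hab h
  rw [lam2, h2, h1]
  ring

/-- The elliptic coordinates of a point do not depend on the direction, except for the signs. -/
lemma IsTangentState.coord_eq (hb : α < b) (hab : b < a)
    (h : IsTangentState (a - α) (b - α) X v ε ξ ϑ)
    (h' : IsTangentState (a - α) (b - α) X v' ε' ξ' ϑ') :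
    ξ' ^ 2 = ξ ^ 2 ∧ Real.cos ϑ' = Real.cos ϑ ∧ ε' * Real.sin ϑ' = ε * Real.sin ϑ := by
  have h1 : ξ' ^ 2 = ξ ^ 2 := by
    have := h.lam1_eq hb hab
    have := h'.lam1_eq hb hab
    linarith
  refine ⟨h1, ?_, ?_⟩
  · have := h'.pos_x
    rw [h.pos_x, h1] at this
    exact (mul_left_cancel₀ (radical_pos (by linarith) ξ).ne' this).symm
  · have := h'.pos_y
    rw [h.pos_y, h1] at this
    refine mul_left_cancel₀ (radical_pos (by linarith : 0 < b - α) ξ).ne' ?_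
    linear_combination -this

/-- A normal of the confocal ellipse through the point with coordinates `(ξ, ϑ)`. -/
def radialVec (p q ε ξ ϑ : ℝ) : Plane :=
  !₂[√(q + ξ ^ 2) * Real.cos ϑ, ε * (√(p + ξ ^ 2) * Real.sin ϑ)]

/-- A normal of the confocal hyperbola (or of the axis) through the point with coordinates
`(ξ, ϑ)`, which is a tangent vector of the ellipse through that point. -/
def angularVec (p q ε ξ ϑ : ℝ) : Plane :=
  !₂[-(√(p + ξ ^ 2) * Real.sin ϑ), ε * (√(q + ξ ^ 2) * Real.cos ϑ)]

lemma plane_ext {x y : Plane} (h0 : x 0 = y 0) (h1 : x 1 = y 1) : x = y := by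
  ext i; fin_cases i
  · exact h0
  · exact h1

lemma inner_radialVec_angularVec {p q : ℝ} (hε : ε = 1 ∨ ε = -1) :
    inner ℝ (radialVec p q ε ξ ϑ) (angularVec p q ε ξ ϑ) = 0 := by
  have : ε ^ 2 = 1 := by rcases hε with h | h <;> simp [h]
  simp [radialVec, angularVec, PiLp.inner_apply, Fin.sum_univ_two]
  linear_combination (√(p + ξ ^ 2) * Real.sin ϑ * √(q + ξ ^ 2) * Real.cos ϑ) * this

lemma IsTangentState.exists_velocity_eq {p q : ℝ} (h : IsTangentState p q X v ε ξ ϑ) :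
    ∃ c, 0 < c ∧ v = (c * ξ) • radialVec p q ε ξ ϑ +
      (c * angularRoot p q ϑ) • angularVec p q ε ξ ϑ := by
  obtain ⟨c, hc, h0, h1⟩ := h.velocity
  refine ⟨c, hc, plane_ext ?_ ?_⟩
  · simp [radialVec, angularVec, h0]; ring
  · simp [radialVec, angularVec, h1]; ring

/-- Two tangents of the caustic through a point are related by signs: if the components of the
velocities along the two normals differ by the factors `s₁` and `s₂`, up to a common positive
factor, then `ξ` and `ε` differ by these factors. -/
lemma IsTangentState.sign_eq (hb : α < b) (hab : b < a)
    (h : IsTangentState (a - α) (b - α) X v ε ξ ϑ)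
    (h' : IsTangentState (a - α) (b - α) X v' ε' ξ' ϑ') {d s₁ s₂ : ℝ} (hd : 0 < d)
    (hs₂ : s₂ = 1 ∨ s₂ = -1)
    (hv : v' = (d * (s₁ * ξ)) • radialVec (a - α) (b - α) ε ξ ϑ +
      (d * (s₂ * angularRoot (a - α) (b - α) ϑ)) • angularVec (a - α) (b - α) ε ξ ϑ) :
    ξ' = s₁ * ξ ∧ ε' = s₂ * ε := by
  obtain ⟨hξ, hcos, hsin⟩ := h.coord_eq hb hab h'
  obtain ⟨c, hc, hv'⟩ := h'.exists_velocity_eq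
  have hp : 0 < a - α := by linarith
  have hq : 0 < b - α := by linarith
  have hρ : angularRoot (a - α) (b - α) ϑ' = angularRoot (a - α) (b - α) ϑ := by
    have hs : Real.sin ϑ' ^ 2 = Real.sin ϑ ^ 2 := by
      rw [Real.sin_sq, Real.sin_sq, hcos]
    rw [angularRoot, angularRoot, hcos, hs]
  have hρ0 := angularRoot_pos hp hq ϑ
  have hA := radical_pos hp ξ
  have hB := radical_pos hq ξ
  rw [hv] at hv'
  have e0 := congrArg (fun w : Plane => w 0) hv'
  have e1 := congrArg (fun w : Plane => w 1) hv'
  simp [radialVec, angularVec, hξ, hcos, hρ] at e0 e1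
  have hε2 : ε ^ 2 = 1 := by rcases h.sign with h | h <;> simp [h]
  have hε2' : ε' ^ 2 = 1 := by rcases h'.sign with h | h <;> simp [h]
  have hsin' : Real.sin ϑ' = ε' * ε * Real.sin ϑ := by
    linear_combination ε' * hsin - Real.sin ϑ' * hε2'
  rw [hsin'] at e0 e1
  have hcs := Real.sin_sq_add_cos_sq ϑ
  generalize √(a - α + ξ ^ 2) = A at *
  generalize √(b - α + ξ ^ 2) = B at *
  generalize angularRoot (a - α) (b - α) ϑ = ρ at *
  generalize Real.sin ϑ = s at *
  generalize Real.cos ϑ = k at *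
  have hn : 0 < B ^ 2 * k ^ 2 + A ^ 2 * s ^ 2 := by
    by_contra! hcon
    have g1 := mul_nonneg (sq_nonneg B) (sq_nonneg k)
    have g2 := mul_nonneg (sq_nonneg A) (sq_nonneg s)
    have h1 : B ^ 2 * k ^ 2 = 0 := by linarith
    have h2 : A ^ 2 * s ^ 2 = 0 := by linarith
    have h3 : k ^ 2 = 0 := by simpa [hB.ne'] using h1
    have h4 : s ^ 2 = 0 := by simpa [hA.ne'] using h2
    rw [h3, h4] at hcs
    norm_num at hcs
  -- the components in the directions of the two normals
  have e2 : d * (s₁ * ξ) * (A * s) + d * (s₂ * ρ) * (B * k) =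
      c * ξ' * (A * s) + c * ρ * (ε' * ε) * (B * k) := by
    linear_combination ε * e1 - (d * (s₁ * ξ) * (A * s) + d * (s₂ * ρ) * (B * k) -
      c * ξ' * (A * s)) * hε2 + c * ξ' * (A * s) * ε ^ 2 * hε2'
  have f1 : d * (s₁ * ξ) = c * ξ' := by
    refine mul_right_cancel₀ hn.ne' ?_
    linear_combination B * k * e0 + A * s * e2
  have f2 : d * s₂ = c * (ε' * ε) := by
    refine mul_right_cancel₀ (mul_pos hρ0 hn).ne' ?_
    linear_combination -A * s * e0 + B * k * e2
  have f3 : ε' * ε = s₂ ∧ d = c := by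
    rcases h.sign with h | h <;> rcases h'.sign with h' | h' <;> rcases hs₂ with hs | hs <;>
      subst h h' hs <;> norm_num at f2 ⊢ <;> linarith
  obtain ⟨f3, rfl⟩ := f3
  refine ⟨(mul_left_cancel₀ hd.ne' f1).symm, ?_⟩
  rw [← f3, mul_assoc, ← sq, hε2, mul_one]

end States

/-! ### Reflections in elliptic coordinates -/

section Reflection

/-- Reflection in the line orthogonal to `n`, applied to a vector decomposed along `n`. -/
lemma reflection_smul_add {n t v : Plane} (s : ℝ) (hv : v = s • n + t) (ht : inner ℝ n t = 0) :
    (ℝ ∙ n)ᗮ.reflection v = -(s • n) + t := by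
  rw [hv, map_add, map_smul, Submodule.reflection_orthogonalComplement_singleton_eq_neg,
    Submodule.reflection_mem_subspace_eq_self
      (Submodule.mem_orthogonal_singleton_iff_inner_right.2 ht),
    smul_neg]

variable {k l : ℕ} {a b α : ℝ} {β : Fin k → ℝ} {γ : Fin l → ℝ} {X v : Plane} {ε ξ ϑ : ℝ}

/-- The value of `sin² ϑ`, that is, of `(λ₂ - b) / (a - b)`, on a hyperbola or on an axis. -/
def Wall.sinSq (a b : ℝ) (γ : Fin l → ℝ) : Wall k l → ℝ
  | .ellipse _ => 0
  | .hyperbola j => (γ j - b) / (a - b)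
  | .xAxis => 0
  | .yAxis => 1

/-- The wall is a hyperbola or an axis. -/
def Wall.IsAngular : Wall k l → Prop
  | .ellipse _ => False
  | _ => True

lemma IsTangentState.of_mem_ellipse (hα : α < b) (hab : b < a) {δ : ℝ} (hδ : δ < α)
    (h : IsTangentState (a - α) (b - α) X v ε ξ ϑ) (hX : conicEq a b δ X = 0) :
    ξ ^ 2 = α - δ ∧
      ∃ μ : ℝ, μ ≠ 0 ∧ conicNormal a b δ X = μ • radialVec (a - α) (b - α) ε ξ ϑ := by
  have hp : 0 < a - α := by linarith
  have hq : 0 < b - α := by linarith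
  have hε : ε ^ 2 = 1 := by rcases h.sign with h | h <;> simp [h]
  have hA := radical_pos hp ξ
  have hB := radical_pos hq ξ
  have hA2 := radical_sq hp ξ
  have hB2 := radical_sq hq ξ
  have hcs := Real.sin_sq_add_cos_sq ϑ
  have h1 : 0 < a - δ := by linarith
  have h2 : 0 < b - δ := by linarith
  have hξ : ξ ^ 2 = α - δ := by
    rw [conicEq, h.pos_x, h.pos_y, mul_pow, mul_pow, mul_pow, hA2, hB2, hε] at hX
    have h3 : 0 < Real.cos ϑ ^ 2 * (b - δ) + Real.sin ϑ ^ 2 * (a - δ) := by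
      rcases (sq_nonneg (Real.cos ϑ)).eq_or_lt with h | h
      · rw [← h] at hcs ⊢
        have : Real.sin ϑ ^ 2 = 1 := by linarith
        rw [this]; linarith
      · have := mul_pos h h2
        have := mul_nonneg (sq_nonneg (Real.sin ϑ)) h1.le
        linarith
    have h4 : (ξ ^ 2 - (α - δ)) * (Real.cos ϑ ^ 2 * (b - δ) + Real.sin ϑ ^ 2 * (a - δ)) = 0 := by
      field_simp at hX
      linear_combination hX - (a - δ) * (b - δ) * hcs
    rcases mul_eq_zero.1 h4 with h | h
    · linarith
    · exact absurd h h3.ne'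
  refine ⟨hξ, 1 / (√(a - α + ξ ^ 2) * √(b - α + ξ ^ 2)), by positivity, plane_ext ?_ ?_⟩
  · have : a - δ = √(a - α + ξ ^ 2) ^ 2 := by rw [hA2, hξ]; ring
    simp only [conicNormal, radialVec, h.pos_x, this]
    simp
    field_simp
  · have : b - δ = √(b - α + ξ ^ 2) ^ 2 := by rw [hB2, hξ]; ring
    simp only [conicNormal, radialVec, h.pos_y, this]
    simp
    field_simp

lemma IsTangentState.of_mem_hyperbola (hα : α < b) (hab : b < a) {δ : ℝ} (hδ : b < δ ∧ δ < a)
    (h : IsTangentState (a - α) (b - α) X v ε ξ ϑ) (hX : conicEq a b δ X = 0) :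
    Real.sin ϑ ^ 2 = (δ - b) / (a - b) ∧
      ∃ μ : ℝ, μ ≠ 0 ∧ conicNormal a b δ X = μ • angularVec (a - α) (b - α) ε ξ ϑ := by
  have hp : 0 < a - α := by linarith
  have hq : 0 < b - α := by linarith
  have hε : ε ^ 2 = 1 := by rcases h.sign with h | h <;> simp [h]
  have hA2 := radical_sq hp ξ
  have hB2 := radical_sq hq ξ
  have hcs := Real.sin_sq_add_cos_sq ϑ
  have h1 : 0 < a - δ := by linarith
  have h2 : 0 < δ - b := by linarith
  have h2' : b - δ ≠ 0 := by linarith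
  have h0 : 0 < a - b := by linarith
  have hs : Real.sin ϑ ^ 2 = (δ - b) / (a - b) := by
    rw [conicEq, h.pos_x, h.pos_y, mul_pow, mul_pow, mul_pow, hA2, hB2, hε] at hX
    have hc2 : Real.cos ϑ ^ 2 = 1 - Real.sin ϑ ^ 2 := by linarith
    rw [hc2] at hX
    have h3 : 0 < (a - α + ξ ^ 2) * (δ - b) + (b - α + ξ ^ 2) * (a - δ) := by
      have := mul_pos (by positivity : 0 < a - α + ξ ^ 2) h2
      have := mul_pos (by positivity : 0 < b - α + ξ ^ 2) h1
      linarith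
    have h4 : ((a - b) * Real.sin ϑ ^ 2 - (δ - b)) *
        ((a - α + ξ ^ 2) * (δ - b) + (b - α + ξ ^ 2) * (a - δ)) = 0 := by
      field_simp at hX
      linear_combination (a - b) * hX
    rw [eq_div_iff h0.ne']
    rcases mul_eq_zero.1 h4 with h | h
    · linarith
    · exact absurd h h3.ne'
  have hc : Real.cos ϑ ^ 2 = (a - δ) / (a - b) := by
    have : Real.cos ϑ ^ 2 = 1 - Real.sin ϑ ^ 2 := by linarith
    rw [this, hs]; field_simp; ring
  have hs0 : Real.sin ϑ ≠ 0 := by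
    intro h; rw [h] at hs
    have := div_pos h2 h0
    norm_num at hs; linarith
  have hc0 : Real.cos ϑ ≠ 0 := by
    intro h; rw [h] at hc
    have := div_pos h1 h0
    norm_num at hc; linarith
  refine ⟨hs, -1 / ((a - b) * (Real.sin ϑ * Real.cos ϑ)), ?_, plane_ext ?_ ?_⟩
  · exact div_ne_zero (by norm_num) (mul_ne_zero h0.ne' (mul_ne_zero hs0 hc0))
  · have : a - δ = (a - b) * Real.cos ϑ ^ 2 := by rw [hc]; field_simp
    simp only [conicNormal, angularVec, h.pos_x, this]
    simp
    field_simp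
  · have : b - δ = -((a - b) * Real.sin ϑ ^ 2) := by rw [hs]; field_simp; ring
    simp only [conicNormal, angularVec, h.pos_y, this]
    simp
    field_simp

lemma IsTangentState.of_mem_angular_wall (hα : α < b) (hab : b < a)
    (hγ : ∀ j, b < γ j ∧ γ j < a) {w : Wall k l} (hw : w.IsAngular)
    (h : IsTangentState (a - α) (b - α) X v ε ξ ϑ) (hX : w.eqn a b β γ X = 0) :
    Real.sin ϑ ^ 2 = w.sinSq a b γ ∧
      ∃ μ : ℝ, μ ≠ 0 ∧ w.normal a b β γ X = μ • angularVec (a - α) (b - α) ε ξ ϑ := by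
  have hp : 0 < a - α := by linarith
  have hq : 0 < b - α := by linarith
  have hA := radical_pos hp ξ
  have hB := radical_pos hq ξ
  have hcs := Real.sin_sq_add_cos_sq ϑ
  have hε : ε ≠ 0 := by rcases h.sign with h | h <;> simp [h]
  cases w with
  | ellipse i => exact hw.elim
  | hyperbola j => exact h.of_mem_hyperbola hα hab (hγ j) hX
  | xAxis =>
    have hs : Real.sin ϑ = 0 := by
      have hX : X 1 = 0 := hX
      rw [h.pos_y] at hX
      simpa [hε, hB.ne'] using hX
    have hc : Real.cos ϑ ≠ 0 := by
      intro hc; rw [hs, hc] at hcs; norm_num at hcs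
    refine ⟨by rw [hs]; simp [Wall.sinSq], 1 / (ε * √(b - α + ξ ^ 2) * Real.cos ϑ),
      one_div_ne_zero (mul_ne_zero (mul_ne_zero hε hB.ne') hc), plane_ext ?_ ?_⟩
    · simp [Wall.normal, angularVec, hs]
    · simp [Wall.normal, angularVec]
      field_simp
  | yAxis =>
    have hc : Real.cos ϑ = 0 := by
      have hX : X 0 = 0 := hX
      rw [h.pos_x] at hX
      simpa [hA.ne'] using hX
    have hs : Real.sin ϑ ≠ 0 := by
      intro hs; rw [hs, hc] at hcs; norm_num at hcs
    have hs2 : Real.sin ϑ ^ 2 = 1 := by rw [hc] at hcs; linarith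
    refine ⟨by rw [hs2]; simp [Wall.sinSq], -1 / (√(a - α + ξ ^ 2) * Real.sin ϑ),
      div_ne_zero (by norm_num) (mul_ne_zero hA.ne' hs), plane_ext ?_ ?_⟩
    · simp [Wall.normal, angularVec]
      field_simp
    · simp [Wall.normal, angularVec, hc]

variable {D : Set Plane} {P Q R : Plane} {ε' ξ' ϑ' : ℝ}

lemma exists_pos_smul_of_sameRay {x y : Plane} (h : SameRay ℝ x y) (hx : x ≠ 0) (hy : y ≠ 0) :
    ∃ c : ℝ, 0 < c ∧ x = c • y := by
  obtain ⟨r, s, hr, hs, h⟩ := h.exists_pos hx hy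
  refine ⟨s / r, div_pos hs hr, ?_⟩
  rw [div_eq_inv_mul, mul_smul, ← h, smul_smul, inv_mul_cancel₀ hr.ne', one_smul]

lemma SmoothReflection.ellipse_change (hα : α < b) (hab : b < a) (hβ : ∀ i, β i < α)
    (hPQ : P ≠ Q) (hQR : Q ≠ R)
    (h : IsTangentState (a - α) (b - α) Q (Q - P) ε ξ ϑ)
    (h' : IsTangentState (a - α) (b - α) Q (R - Q) ε' ξ' ϑ') {i : Fin k}
    (hr : SmoothReflection a b β γ D P Q R (.ellipse i)) : ξ' = -ξ ∧ ε' = ε := by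
  obtain ⟨heq, -, hray⟩ := hr
  obtain ⟨-, μ, hμ, hn⟩ := h.of_mem_ellipse hα hab (hβ i) heq
  obtain ⟨c, hc, hv⟩ := h.exists_velocity_eq
  have hin := inner_radialVec_angularVec (ξ := ξ) (ϑ := ϑ) (p := a - α) (q := b - α) h.sign
  obtain ⟨d, hd, hray⟩ := exists_pos_smul_of_sameRay hray (sub_ne_zero.2 hQR.symm) (by
    simpa [sub_eq_zero] using hPQ.symm)
  rw [reflection_smul_add (t := (c * angularRoot (a - α) (b - α) ϑ) •
      angularVec (a - α) (b - α) ε ξ ϑ) (c * ξ / μ)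
      (by rw [hv, Wall.normal, hn, smul_smul, div_mul_cancel₀ _ hμ])
      (by rw [Wall.normal, hn, inner_smul_left, inner_smul_right, hin]; simp),
    Wall.normal, hn, smul_smul, div_mul_cancel₀ _ hμ] at hray
  have := h.sign_eq hα hab h' (d := d * c) (s₁ := -1) (s₂ := 1) (by positivity) (Or.inl rfl) (by
    rw [hray]; module)
  simpa using this

lemma SmoothReflection.angular_change (hα : α < b) (hab : b < a)
    (hγ : ∀ j, b < γ j ∧ γ j < a) (hPQ : P ≠ Q) (hQR : Q ≠ R)
    (h : IsTangentState (a - α) (b - α) Q (Q - P) ε ξ ϑ)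
    (h' : IsTangentState (a - α) (b - α) Q (R - Q) ε' ξ' ϑ') {w : Wall k l} (hw : w.IsAngular)
    (hr : SmoothReflection a b β γ D P Q R w) : ξ' = ξ ∧ ε' = -ε := by
  obtain ⟨heq, -, hray⟩ := hr
  obtain ⟨-, μ, hμ, hn⟩ := h.of_mem_angular_wall hα hab hγ hw heq
  obtain ⟨c, hc, hv⟩ := h.exists_velocity_eq
  have hin := inner_radialVec_angularVec (ξ := ξ) (ϑ := ϑ) (p := a - α) (q := b - α) h.sign
  obtain ⟨d, hd, hray⟩ := exists_pos_smul_of_sameRay hray (sub_ne_zero.2 hQR.symm) (by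
    simpa [sub_eq_zero] using hPQ.symm)
  rw [reflection_smul_add (t := (c * ξ) • radialVec (a - α) (b - α) ε ξ ϑ)
      (c * angularRoot (a - α) (b - α) ϑ / μ)
      (by rw [hv, hn, smul_smul, div_mul_cancel₀ _ hμ, add_comm])
      (by rw [hn, inner_smul_left, inner_smul_right, real_inner_comm, hin]; simp),
    hn, smul_smul, div_mul_cancel₀ _ hμ] at hray
  have := h.sign_eq hα hab h' (d := d * c) (s₁ := 1) (s₂ := -1) (by positivity) (Or.inr rfl) (by
    rw [hray]; module)
  simpa using this

lemma CornerReflection.change (hα : α < b) (hab : b < a) (hPQ : P ≠ Q) (hQR : Q ≠ R)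
    (h : IsTangentState (a - α) (b - α) Q (Q - P) ε ξ ϑ)
    (h' : IsTangentState (a - α) (b - α) Q (R - Q) ε' ξ' ϑ') {w w' : Wall k l}
    (hr : CornerReflection a b β γ D P Q R w w') : ξ' = -ξ ∧ ε' = -ε := by
  obtain ⟨-, -, -, -, hray⟩ := hr
  obtain ⟨c, hc, hv⟩ := h.exists_velocity_eq
  obtain ⟨d, hd, hray⟩ := exists_pos_smul_of_sameRay hray (sub_ne_zero.2 hQR.symm)
    (sub_ne_zero.2 hPQ)
  have hv2 : P - Q = -(Q - P) := by abel
  have := h.sign_eq hα hab h' (d := d * c) (s₁ := -1) (s₂ := -1) (by positivity) (Or.inr rfl) (by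
    rw [hray, hv2, hv]; module)
  simpa using this

/-- Of the two walls at a right angle that a tangent of the caustic can reach, one is an ellipse
and the other one a hyperbola or an axis. -/
lemma CornerReflection.isAngular_iff (hα : α < b) (hab : b < a) (hβ : ∀ i, β i < α)
    (hγ : ∀ j, b < γ j ∧ γ j < a) (hβ_inj : Function.Injective β)
    (hγ_inj : Function.Injective γ)
    (h : IsTangentState (a - α) (b - α) Q v ε ξ ϑ) {w w' : Wall k l}
    (hr : CornerReflection a b β γ D P Q R w w') : w.IsAngular ↔ ¬w'.IsAngular := by
  obtain ⟨hne, hw, hw', -⟩ := hr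
  have hang : w.IsAngular → w'.IsAngular → w.sinSq a b γ = w'.sinSq a b γ := fun h1 h2 => by
    rw [← (h.of_mem_angular_wall hα hab hγ h1 hw).1, (h.of_mem_angular_wall hα hab hγ h2 hw').1]
  have hγ' : ∀ j, 0 < (γ j - b) / (a - b) ∧ (γ j - b) / (a - b) < 1 := fun j => by
    have := hγ j
    exact ⟨div_pos (by linarith) (by linarith),
      (div_lt_one (by linarith)).2 (by linarith)⟩
  constructor
  · intro h1 h2
    have := hang h1 h2
    cases w with
    | ellipse i => exact h1
    | hyperbola j =>
      cases w' with
      | ellipse i => exact h2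
      | hyperbola j' =>
        have e : (γ j - b) / (a - b) = (γ j' - b) / (a - b) := this
        rw [div_left_inj' (by linarith : a - b ≠ 0)] at e
        exact hne (congrArg _ (hγ_inj (by linarith)))
      | xAxis => exact (hγ' j).1.ne' this
      | yAxis => exact (hγ' j).2.ne this
    | xAxis =>
      cases w' with
      | ellipse i => exact h2
      | hyperbola j' => exact (hγ' j').1.ne this
      | xAxis => exact hne rfl
      | yAxis => exact zero_ne_one this
    | yAxis =>
      cases w' with
      | ellipse i => exact h2
      | hyperbola j' => exact (hγ' j').2.ne' this
      | xAxis => exact one_ne_zero this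
      | yAxis => exact hne rfl
  · intro h2
    cases w' with
    | ellipse i' =>
      cases w with
      | ellipse i =>
        have e1 := (h.of_mem_ellipse hα hab (hβ i) hw).1
        have e2 := (h.of_mem_ellipse hα hab (hβ i') hw').1
        exact hne (congrArg _ (hβ_inj (by linarith)))
      | hyperbola j => trivial
      | xAxis => trivial
      | yAxis => trivial
    | hyperbola j => exact absurd trivial h2
    | xAxis => exact absurd trivial h2
    | yAxis => exact absurd trivial h2

section Vertex

variable (hα : α < b) (hab : b < a)
  (hPQ : P ≠ Q) (hQR : Q ≠ R)
  (h : IsTangentState (a - α) (b - α) Q (Q - P) ε ξ ϑ)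
  (h' : IsTangentState (a - α) (b - α) Q (R - Q) ε' ξ' ϑ')
include hα hab hPQ hQR h h'

lemma ReflectsOff.radial_neg (hβ : ∀ i, β i < α) {i : Fin k}
    (hr : ReflectsOff a b β γ D P Q R (.ellipse i)) :
    ξ' = -ξ := by
  rcases hr with hr | ⟨w', hr | hr⟩
  · exact (hr.ellipse_change hα hab hβ hPQ hQR h h').1
  · exact (hr.change hα hab hPQ hQR h h').1
  · exact (hr.change hα hab hPQ hQR h h').1

lemma ReflectsOff.sense_neg (hγ : ∀ j, b < γ j ∧ γ j < a) {w : Wall k l} (hw : w.IsAngular)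
    (hr : ReflectsOff a b β γ D P Q R w) : ε' = -ε := by
  rcases hr with hr | ⟨w', hr | hr⟩
  · exact (hr.angular_change hα hab hγ hPQ hQR h h' hw).2
  · exact (hr.change hα hab hPQ hQR h h').2
  · exact (hr.change hα hab hPQ hQR h h').2

lemma ReflectsOff.radial_eq (hβ : ∀ i, β i < α) (hγ : ∀ j, b < γ j ∧ γ j < a)
    (hβ_inj : Function.Injective β) (hγ_inj : Function.Injective γ)
    {w : Wall k l} (hr : ReflectsOff a b β γ D P Q R w)
    (hno : ∀ i, ¬ReflectsOff a b β γ D P Q R (.ellipse i)) : ξ' = ξ := by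
  have hang : ∀ w : Wall k l, ReflectsOff a b β γ D P Q R w → w.IsAngular := by
    intro w hw
    cases w with
    | ellipse i => exact absurd hw (hno i)
    | _ => trivial
  rcases hr with hr | ⟨w', hr | hr⟩
  · exact (hr.angular_change hα hab hγ hPQ hQR h h' (hang w (Or.inl hr))).1
  · exact absurd (hang w' (Or.inr ⟨w, Or.inr hr⟩))
      ((hr.isAngular_iff hα hab hβ hγ hβ_inj hγ_inj h).1 (hang w (Or.inr ⟨w', Or.inl hr⟩)))
  · exact absurd (hang w (Or.inr ⟨w', Or.inr hr⟩))
      ((hr.isAngular_iff hα hab hβ hγ hβ_inj hγ_inj h).1 (hang w' (Or.inr ⟨w, Or.inl hr⟩)))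

lemma ReflectsOff.sense_eq (hβ : ∀ i, β i < α) (hγ : ∀ j, b < γ j ∧ γ j < a)
    (hβ_inj : Function.Injective β) (hγ_inj : Function.Injective γ)
    {w : Wall k l} (hr : ReflectsOff a b β γ D P Q R w)
    (hno : ∀ w : Wall k l, w.IsAngular → ¬ReflectsOff a b β γ D P Q R w) : ε' = ε := by
  have hang : ∀ w : Wall k l, ReflectsOff a b β γ D P Q R w → ¬w.IsAngular :=
    fun w hw hw' => hno w hw' hw
  rcases hr with hr | ⟨w', hr | hr⟩
  · have hw := hang w (Or.inl hr)
    cases w with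
    | ellipse i => exact (hr.ellipse_change hα hab hβ hPQ hQR h h').2
    | _ => exact absurd trivial hw
  · exact absurd ((hr.isAngular_iff hα hab hβ hγ hβ_inj hγ_inj h).2
      (hang w' (Or.inr ⟨w, Or.inr hr⟩))) (hang w (Or.inr ⟨w', Or.inl hr⟩))
  · exact absurd ((hr.isAngular_iff hα hab hβ hγ hβ_inj hγ_inj h).2
      (hang w (Or.inr ⟨w', Or.inr hr⟩))) (hang w' (Or.inr ⟨w, Or.inl hr⟩))

end Vertex

lemma ReflectsOff.mem {w : Wall k l} (hr : ReflectsOff a b β γ D P Q R w) :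
    w.eqn a b β γ Q = 0 := by
  rcases hr with hr | ⟨w', hr | hr⟩
  · exact hr.1
  · exact hr.2.1
  · exact hr.2.2.1

end Reflection

/-! ### Proper extrema at a vertex -/

section Turning

lemma eventually_slope_pos {G : ℝ → ℝ} {x d : ℝ} (h : HasDerivAt G d x) (hd : 0 < d) :
    ∀ᶠ y in 𝓝[≠] x, 0 < (y - x) * (G y - G x) := by
  have h1 := (hasDerivAt_iff_tendsto_slope.1 h).eventually (lt_mem_nhds hd)
  filter_upwards [h1, self_mem_nhdsWithin] with y hy hyx
  have h2 : y - x ≠ 0 := sub_ne_zero.2 hyx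
  rw [slope_def_field] at hy
  have h3 : (y - x) * (G y - G x) = (G y - G x) / (y - x) * (y - x) ^ 2 := by field_simp
  rw [h3]
  positivity

lemma tendsto_nhdsLT {x : ℝ → ℝ} (h : StrictMono x) (hc : Continuous x) (m : ℝ) :
    Filter.Tendsto x (𝓝[<] m) (𝓝[<] (x m)) :=
  tendsto_nhdsWithin_iff.2 ⟨hc.continuousAt.tendsto.mono_left nhdsWithin_le_nhds,
    Filter.eventually_of_mem self_mem_nhdsWithin fun _ ht => h ht⟩

lemma tendsto_nhdsGT {x : ℝ → ℝ} (h : StrictMono x) (hc : Continuous x) (m : ℝ) :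
    Filter.Tendsto x (𝓝[>] m) (𝓝[>] (x m)) :=
  tendsto_nhdsWithin_iff.2 ⟨hc.continuousAt.tendsto.mono_left nhdsWithin_le_nhds,
    Filter.eventually_of_mem self_mem_nhdsWithin fun _ ht => h ht⟩

variable {F G x₁ x₂ : ℝ → ℝ} {m d₁ d₂ : ℝ}

/-- A function that is, on the two sides of `m`, a function `G` of increasing coordinates `x₁` and
`x₂` has a proper local minimum at `m` if `G` decreases on arrival and increases on departure. -/
lemma isLocalMin_of_turn (h₁ : ∀ᶠ t in 𝓝[<] m, F t = G (x₁ t))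
    (h₂ : ∀ᶠ t in 𝓝[>] m, F t = G (x₂ t)) (hm₁ : F m = G (x₁ m)) (hm₂ : F m = G (x₂ m))
    (hx₁ : StrictMono x₁) (hc₁ : Continuous x₁) (hx₂ : StrictMono x₂) (hc₂ : Continuous x₂)
    (hd₁ : HasDerivAt G d₁ (x₁ m)) (hd₂ : HasDerivAt G d₂ (x₂ m)) (hs₁ : d₁ < 0) (hs₂ : 0 < d₂) :
    IsLocalMin F m ∧ ¬IsLocalMax F m := by
  have e₁ : ∀ᶠ t in 𝓝[<] m, F m < F t := by
    have := (eventually_slope_pos hd₁.neg (neg_pos.2 hs₁)).filter_mono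
      (nhdsWithin_mono _ fun y (hy : y < x₁ m) => hy.ne)
    filter_upwards [h₁, (tendsto_nhdsLT hx₁ hc₁ m).eventually this, self_mem_nhdsWithin]
      with t ht1 ht2 ht3
    have h4 : x₁ t - x₁ m < 0 := sub_neg.2 (hx₁ ht3)
    simp only [Pi.neg_apply] at ht2
    rw [ht1, hm₁]
    nlinarith
  have e₂ : ∀ᶠ t in 𝓝[>] m, F m < F t := by
    have := (eventually_slope_pos hd₂ hs₂).filter_mono
      (nhdsWithin_mono _ fun y (hy : x₂ m < y) => hy.ne')
    filter_upwards [h₂, (tendsto_nhdsGT hx₂ hc₂ m).eventually this, self_mem_nhdsWithin]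
      with t ht1 ht2 ht3
    have h4 : 0 < x₂ t - x₂ m := sub_pos.2 (hx₂ ht3)
    rw [ht1, hm₂]
    nlinarith
  refine ⟨?_, fun hmax => ?_⟩
  · have : ∀ᶠ t in 𝓝[<] m ⊔ 𝓝[>] m, F m < F t := Filter.eventually_sup.2 ⟨e₁, e₂⟩
    rw [nhdsLT_sup_nhdsGT, eventually_nhdsWithin_iff] at this
    filter_upwards [this] with t ht
    rcases eq_or_ne t m with rfl | h
    · exact le_rfl
    · exact (ht h).le
  · obtain ⟨t, ht1, ht2⟩ := (e₁.and (hmax.filter_mono nhdsWithin_le_nhds)).exists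
    exact absurd ht1 (not_lt.2 ht2)

lemma isLocalMax_of_turn (h₁ : ∀ᶠ t in 𝓝[<] m, F t = G (x₁ t))
    (h₂ : ∀ᶠ t in 𝓝[>] m, F t = G (x₂ t)) (hm₁ : F m = G (x₁ m)) (hm₂ : F m = G (x₂ m))
    (hx₁ : StrictMono x₁) (hc₁ : Continuous x₁) (hx₂ : StrictMono x₂) (hc₂ : Continuous x₂)
    (hd₁ : HasDerivAt G d₁ (x₁ m)) (hd₂ : HasDerivAt G d₂ (x₂ m)) (hs₁ : 0 < d₁) (hs₂ : d₂ < 0) :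
    ¬IsLocalMin F m ∧ IsLocalMax F m := by
  have := isLocalMin_of_turn (F := fun t => -F t) (G := -G)
    (h₁.mono fun t ht => congrArg (-·) ht) (h₂.mono fun t ht => congrArg (-·) ht)
    (congrArg (-·) hm₁) (congrArg (-·) hm₂) hx₁ hc₁ hx₂ hc₂ hd₁.neg hd₂.neg
    (neg_neg_of_pos hs₁) (neg_pos.2 hs₂)
  refine ⟨fun h => this.2 h.neg, ?_⟩
  simpa using this.1.neg

end Turning

section Path

variable (A : ℤ → Plane)

lemma path_of_mem_Ico (m : ℤ) {t : ℝ} (ht : (m : ℝ) ≤ t) (ht' : t < m + 1) :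
    path A t = AffineMap.lineMap (A m) (A (m + 1)) (t - m) := by
  have : ⌊t⌋ = m := Int.floor_eq_iff.2 ⟨ht, ht'⟩
  rw [path, Int.fract, this]

lemma path_intCast (m : ℤ) : path A m = A m := by
  rw [path_of_mem_Ico A m le_rfl (by linarith), sub_self, AffineMap.lineMap_apply_zero]

lemma eventually_path_right (m : ℤ) : ∀ᶠ t in 𝓝[>] (m : ℝ),
    path A t = AffineMap.lineMap (A m) (A (m + 1)) (t - m) := by
  filter_upwards [Ioo_mem_nhdsGT (by linarith : (m : ℝ) < m + 1)] with t ht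
  exact path_of_mem_Ico A m ht.1.le ht.2

lemma eventually_path_left (m : ℤ) : ∀ᶠ t in 𝓝[<] (m : ℝ),
    path A t = AffineMap.lineMap (A (m - 1)) (A m) (t - m + 1) := by
  filter_upwards [Ioo_mem_nhdsLT (by linarith : (m : ℝ) - 1 < m)] with t ht
  rw [path_of_mem_Ico A (m - 1) (by push_cast; exact ht.1.le) (by push_cast; linarith [ht.2]),
    sub_add_cancel]
  congr 1
  push_cast
  ring

end Path

/-! ### Counting -/

section Counting

lemma ncard_int_eq_sum (N : ℕ) (p : ℤ → Prop) [DecidablePred p] :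
    ({m : ℤ | 0 ≤ m ∧ m < N ∧ p m}.ncard : ℤ) =
      ∑ n ∈ Finset.range N, if p (n : ℤ) then 1 else 0 := by
  have : {m : ℤ | 0 ≤ m ∧ m < N ∧ p m} =
      Nat.cast '' (((Finset.range N).filter fun n : ℕ => p n : Finset ℕ) : Set ℕ) := by
    ext m
    simp only [Set.mem_ofPred_eq, Set.mem_image, Finset.coe_filter, Finset.mem_range]
    constructor
    · rintro ⟨h0, h1, h2⟩
      lift m to ℕ using h0
      exact ⟨m, ⟨by exact_mod_cast h1, h2⟩, rfl⟩
    · rintro ⟨n, ⟨h1, h2⟩, rfl⟩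
      exact ⟨Int.natCast_nonneg n, by exact_mod_cast h1, h2⟩
  rw [this, Set.ncard_image_of_injective _ Nat.cast_injective, Set.ncard_coe_finset,
    Finset.card_filter]
  push_cast
  rfl

/-- The number of times at which an increasing angle meets a residue class modulo `π`. -/
lemma ncard_crossings {ϑ : ℝ → ℝ} (hm : StrictMono ϑ) (hc : Continuous ϑ) (n c : ℝ) :
    {t : ℝ | n ≤ t ∧ t < n + 1 ∧ ∃ j : ℤ, ϑ (t - n) = j * Real.pi + c}.Finite ∧
    ({t : ℝ | n ≤ t ∧ t < n + 1 ∧ ∃ j : ℤ, ϑ (t - n) = j * Real.pi + c}.ncard : ℤ) =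
      ⌈(ϑ 1 - c) / Real.pi⌉ - ⌈(ϑ 0 - c) / Real.pi⌉ := by
  set S := {t : ℝ | n ≤ t ∧ t < n + 1 ∧ ∃ j : ℤ, ϑ (t - n) = j * Real.pi + c} with hS
  have hπ := Real.pi_pos
  have hinj : Function.Injective fun t : ℝ => (ϑ (t - n) - c) / Real.pi := by
    intro s t hst
    have h1 : ϑ (s - n) - c = ϑ (t - n) - c := (div_left_inj' hπ.ne').1 hst
    have := hm.injective (sub_left_inj.1 h1)
    linarith
  have himg : (fun t : ℝ => (ϑ (t - n) - c) / Real.pi) '' S =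
      Int.cast '' ((Finset.Ico ⌈(ϑ 0 - c) / Real.pi⌉ ⌈(ϑ 1 - c) / Real.pi⌉ : Finset ℤ) :
        Set ℤ) := by
    ext y
    simp only [hS, Set.mem_image, Set.mem_ofPred_eq, Finset.coe_Ico, Set.mem_Ico]
    constructor
    · rintro ⟨t, ⟨h1, h2, j, hj⟩, rfl⟩
      refine ⟨j, ⟨Int.ceil_le.2 ?_, Int.lt_ceil.2 ?_⟩, ?_⟩
      · rw [div_le_iff₀ hπ]
        have := hm.monotone (by linarith : (0 : ℝ) ≤ t - n)
        linarith
      · rw [lt_div_iff₀ hπ]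
        have := hm (by linarith : t - n < 1)
        linarith
      · rw [hj]; field_simp; ring
    · rintro ⟨j, ⟨h1, h2⟩, rfl⟩
      rw [Int.ceil_le, div_le_iff₀ hπ] at h1
      rw [Int.lt_ceil, lt_div_iff₀ hπ] at h2
      obtain ⟨u, hu, hu'⟩ := intermediate_value_Ico (zero_le_one : (0 : ℝ) ≤ 1) hc.continuousOn
        (⟨by linarith, by linarith⟩ : (j : ℝ) * Real.pi + c ∈ Set.Ico (ϑ 0) (ϑ 1))
      refine ⟨u + n, ⟨by linarith [hu.1], by linarith [hu.2], j, ?_⟩, ?_⟩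
      · rw [add_sub_cancel_right, hu']
      · rw [add_sub_cancel_right, hu']; field_simp; ring
  have hle : ⌈(ϑ 0 - c) / Real.pi⌉ ≤ ⌈(ϑ 1 - c) / Real.pi⌉ := by
    refine Int.ceil_mono (div_le_div_of_nonneg_right ?_ hπ.le)
    linarith [hm zero_lt_one]
  refine ⟨Set.Finite.of_finite_image (himg ▸ (Finset.finite_toSet _).image _) hinj.injOn, ?_⟩
  rw [← Set.ncard_image_of_injective S hinj, himg,
    Set.ncard_image_of_injective _ Int.cast_injective, Set.ncard_coe_finset, Int.card_Ico,
    Int.toNat_of_nonneg (by linarith)]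

/-- The number of zeros in `[0, N)` is the sum of the numbers of zeros in `[n, n + 1)`. -/
lemma ncard_eq_sum_unit_intervals (p : ℝ → Prop) (c : ℕ → ℤ)
    (h : ∀ n : ℕ, {t : ℝ | (n : ℝ) ≤ t ∧ t < n + 1 ∧ p t}.Finite ∧
      ({t : ℝ | (n : ℝ) ≤ t ∧ t < n + 1 ∧ p t}.ncard : ℤ) = c n) (N : ℕ) :
    {t : ℝ | 0 ≤ t ∧ t < N ∧ p t}.Finite ∧
      ({t : ℝ | 0 ≤ t ∧ t < N ∧ p t}.ncard : ℤ) = ∑ n ∈ Finset.range N, c n := by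
  induction N with
  | zero =>
    have : {t : ℝ | 0 ≤ t ∧ t < (0 : ℕ) ∧ p t} = ∅ := by
      ext t; simp; intro h1 h2; linarith
    simp only [this]
    simp
  | succ N ih =>
    have hu : {t : ℝ | 0 ≤ t ∧ t < (N + 1 : ℕ) ∧ p t} =
        {t : ℝ | 0 ≤ t ∧ t < N ∧ p t} ∪ {t : ℝ | (N : ℝ) ≤ t ∧ t < N + 1 ∧ p t} := by
      ext t
      have hN : (0 : ℝ) ≤ N := Nat.cast_nonneg N
      simp only [Set.mem_ofPred_eq, Set.mem_union]
      push_cast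
      constructor
      · rintro ⟨h1, h2, h3⟩
        rcases lt_or_ge t N with h | h
        · exact Or.inl ⟨h1, h, h3⟩
        · exact Or.inr ⟨h, h2, h3⟩
      · rintro (⟨h1, h2, h3⟩ | ⟨h1, h2, h3⟩)
        · exact ⟨h1, by linarith, h3⟩
        · exact ⟨by linarith, h2, h3⟩
    have hd : Disjoint {t : ℝ | 0 ≤ t ∧ t < N ∧ p t}
        {t : ℝ | (N : ℝ) ≤ t ∧ t < N + 1 ∧ p t} := by
      rw [Set.disjoint_left]
      rintro t ⟨-, h1, -⟩ ⟨h2, -⟩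
      linarith
    rw [hu]
    refine ⟨ih.1.union (h N).1, ?_⟩
    rw [Set.ncard_union_eq hd ih.1 (h N).1, Finset.sum_range_succ, ← ih.2, ← (h N).2]
    push_cast
    rfl

end Counting

/-! ### Jumps at the vertices -/

/-- The angle in `(0, π/2)` that belongs to the hyperbola `C_δ`. -/
def hyperbolaAngle (a b δ : ℝ) : ℝ := Real.arcsin √((δ - b) / (a - b))

lemma hyperbolaAngle_mem {a b δ : ℝ} (hδ : b < δ ∧ δ < a) :
    hyperbolaAngle a b δ ∈ Set.Ioo 0 (Real.pi / 2) ∧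
      Real.sin (hyperbolaAngle a b δ) ^ 2 = (δ - b) / (a - b) := by
  have h1 : 0 < (δ - b) / (a - b) := div_pos (by linarith [hδ.1]) (by linarith)
  have h2 : (δ - b) / (a - b) < 1 := (div_lt_one (by linarith)).2 (by linarith [hδ.2])
  have h3 : √((δ - b) / (a - b)) < 1 := by
    rw [Real.sqrt_lt' one_pos]; linarith
  refine ⟨⟨Real.arcsin_pos.2 (Real.sqrt_pos.2 h1), Real.arcsin_lt_pi_div_two.2 h3⟩, ?_⟩
  rw [hyperbolaAngle, Real.sin_arcsin (by linarith [Real.sqrt_nonneg ((δ - b) / (a - b))]) h3.le,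
    Real.sq_sqrt h1.le]

lemma eq_add_int_mul_pi_of_sin_sq_eq {x y : ℝ} (h : Real.sin x ^ 2 = Real.sin y ^ 2) :
    ∃ n : ℤ, x = y + n * Real.pi ∨ x = -y + n * Real.pi := by
  have : Real.cos (2 * y) = Real.cos (2 * x) := by
    rw [Real.cos_two_mul, Real.cos_two_mul, Real.cos_sq', Real.cos_sq', h]
  obtain ⟨n, h | h⟩ := Real.cos_eq_cos_iff.1 this
  · exact ⟨n, Or.inl (by linarith)⟩
  · exact ⟨n, Or.inr (by linarith)⟩

lemma eq_add_two_pi_of_cos_sin_eq {x y : ℝ} (hc : Real.cos x = Real.cos y)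
    (hs : Real.sin x = Real.sin y) : ∃ n : ℤ, x = y + n * (2 * Real.pi) := by
  obtain ⟨n, hn⟩ := Real.Angle.angle_eq_iff_two_pi_dvd_sub.1 (Real.Angle.cos_sin_inj hc hs)
  exact ⟨n, by linarith⟩

section Jumps

variable {p q : ℝ} {P Q R : Plane} {ε ε' : ℝ} {ξ ϑ ξ' ϑ' : ℝ → ℝ}

lemma IsTangentLift.state_one (h : IsTangentLift p q P Q ε ξ ϑ) :
    IsTangentState p q Q (Q - P) ε (ξ 1) (ϑ 1) := by
  simpa using h.state 1

lemma IsTangentLift.state_zero (h : IsTangentLift p q P Q ε ξ ϑ) :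
    IsTangentState p q P (Q - P) ε (ξ 0) (ϑ 0) := by
  simpa using h.state 0

variable {k l : ℕ} {a b α : ℝ} {β : Fin k → ℝ} {γ : Fin l → ℝ} {D : Set Plane}
  {A : ℤ → Plane} {m : ℤ}

/-- A function of the plane that is a function of the coordinate `x` along the lifts of the two
sides at the vertex `A m`, looked at along the trajectory. -/
lemma eventually_coord_eq {f : Plane → ℝ} {G x x' : ℝ → ℝ}
    (h : ∀ u, f (AffineMap.lineMap (A (m - 1)) (A m) u) = G (x u))
    (h' : ∀ u, f (AffineMap.lineMap (A m) (A (m + 1)) u) = G (x' u)) :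
    (∀ᶠ t in 𝓝[<] (m : ℝ), f (path A t) = G (x (t - m + 1))) ∧
    (∀ᶠ t in 𝓝[>] (m : ℝ), f (path A t) = G (x' (t - m))) ∧
    f (path A m) = G (x (m - m + 1)) ∧ f (path A m) = G (x' (m - m)) := by
  refine ⟨?_, ?_, ?_, ?_⟩
  · filter_upwards [eventually_path_left A m] with t ht
    rw [ht, h]
  · filter_upwards [eventually_path_right A m] with t ht
    rw [ht, h']
  · rw [← h, path_intCast, sub_self, zero_add, AffineMap.lineMap_apply_one]
  · rw [← h', path_intCast, sub_self, AffineMap.lineMap_apply_zero]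

lemma strictMono_comp_sub_add {x : ℝ → ℝ} (hx : StrictMono x) (c d : ℝ) :
    StrictMono fun t => x (t - c + d) := fun s t hst => hx (by linarith)

lemma strictMono_comp_sub {x : ℝ → ℝ} (hx : StrictMono x) (c : ℝ) :
    StrictMono fun t => x (t - c) := fun s t hst => hx (by linarith)

variable (hα : α < b) (hab : b < a)
  (L : IsTangentLift (a - α) (b - α) (A (m - 1)) (A m) ε ξ ϑ)
  (L' : IsTangentLift (a - α) (b - α) (A m) (A (m + 1)) ε' ξ' ϑ')
include hα hab L L'

/-- At a reflection off an ellipse `λ₁` has a proper local minimum if the particle comes from the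
caustic, and a proper local maximum if it approaches the caustic. -/
lemma lam1_extremum (hξ : ξ' 0 = -ξ 1) :
    (0 < ξ 1 → IsLocalMin (fun t => lam1 a b (path A t)) m ∧
      ¬IsLocalMax (fun t => lam1 a b (path A t)) m) ∧
    (ξ 1 < 0 → ¬IsLocalMin (fun t => lam1 a b (path A t)) m ∧
      IsLocalMax (fun t => lam1 a b (path A t)) m) := by
  obtain ⟨h1, h2, h3, h4⟩ := eventually_coord_eq (f := lam1 a b) (G := fun x => α - x ^ 2)
    (fun u => (L.state u).lam1_eq hα hab) (fun u => (L'.state u).lam1_eq hα hab)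
  have hG : ∀ x : ℝ, HasDerivAt (fun x => α - x ^ 2) (-(2 * x)) x := fun x => by
    simpa using (hasDerivAt_pow 2 x).const_sub α
  have hm := strictMono_comp_sub_add L.strictMono_radial m 1
  have hc : Continuous fun t : ℝ => ξ (t - m + 1) := L.continuous_radial.comp (by fun_prop)
  have hm' := strictMono_comp_sub L'.strictMono_radial m
  have hc' : Continuous fun t : ℝ => ξ' (t - m) := L'.continuous_radial.comp (by fun_prop)
  have hd := hG (ξ ((m : ℝ) - m + 1))
  have hd' := hG (ξ' ((m : ℝ) - m))
  have e1 : ξ ((m : ℝ) - m + 1) = ξ 1 := by simp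
  have e2 : ξ' ((m : ℝ) - m) = -ξ 1 := by simp [hξ]
  refine ⟨fun hs => ?_, fun hs => ?_⟩
  · exact isLocalMin_of_turn (G := fun x => α - x ^ 2)
      (x₁ := fun t => ξ (t - m + 1)) (x₂ := fun t => ξ' (t - m)) h1 h2 h3 h4 hm hc hm' hc'
      hd hd' (by rw [e1]; linarith)
      (by rw [e2]; linarith)
  · exact isLocalMax_of_turn (G := fun x => α - x ^ 2)
      (x₁ := fun t => ξ (t - m + 1)) (x₂ := fun t => ξ' (t - m)) h1 h2 h3 h4 hm hc hm' hc'
      hd hd' (by rw [e1]; linarith)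
      (by rw [e2]; linarith)

/-- At a reflection off a hyperbola `λ₂` has a proper local minimum or maximum, according to the
sense in which it changes on arrival. -/
lemma lam2_extremum
    (hϑ : Real.sin (ϑ' 0) * Real.cos (ϑ' 0) = -(Real.sin (ϑ 1) * Real.cos (ϑ 1))) :
    (Real.sin (ϑ 1) * Real.cos (ϑ 1) < 0 → IsLocalMin (fun t => lam2 a b (path A t)) m ∧
      ¬IsLocalMax (fun t => lam2 a b (path A t)) m) ∧
    (0 < Real.sin (ϑ 1) * Real.cos (ϑ 1) → ¬IsLocalMin (fun t => lam2 a b (path A t)) m ∧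
      IsLocalMax (fun t => lam2 a b (path A t)) m) := by
  obtain ⟨h1, h2, h3, h4⟩ := eventually_coord_eq (f := lam2 a b)
    (G := fun x => b + (a - b) * Real.sin x ^ 2)
    (fun u => (L.state u).lam2_eq hα hab) (fun u => (L'.state u).lam2_eq hα hab)
  have hG : ∀ x : ℝ, HasDerivAt (fun x => b + (a - b) * Real.sin x ^ 2)
      (2 * (a - b) * (Real.sin x * Real.cos x)) x := fun x => by
    refine ((((Real.hasDerivAt_sin x).pow 2).const_mul (a - b)).const_add b).congr_deriv ?_
    push_cast
    ring
  have hm := strictMono_comp_sub_add L.strictMono_angle m 1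
  have hc : Continuous fun t : ℝ => ϑ (t - m + 1) := L.continuous_angle.comp (by fun_prop)
  have hm' := strictMono_comp_sub L'.strictMono_angle m
  have hc' : Continuous fun t : ℝ => ϑ' (t - m) := L'.continuous_angle.comp (by fun_prop)
  have hd := hG (ϑ ((m : ℝ) - m + 1))
  have hd' := hG (ϑ' ((m : ℝ) - m))
  have e1 : ϑ ((m : ℝ) - m + 1) = ϑ 1 := by simp
  have e2 : ϑ' ((m : ℝ) - m) = ϑ' 0 := by simp
  rw [e1] at hd
  rw [e2, hϑ] at hd'
  have hab' : 0 < 2 * (a - b) := by linarith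
  refine ⟨fun hs => ?_, fun hs => ?_⟩
  · exact isLocalMin_of_turn (G := fun x => b + (a - b) * Real.sin x ^ 2)
      (x₁ := fun t => ϑ (t - m + 1)) (x₂ := fun t => ϑ' (t - m)) h1 h2 h3 h4 hm hc hm' hc'
      (by rw [e1]; exact hd)
      (by rw [e2]; exact hd') (mul_neg_of_pos_of_neg hab' hs) (mul_pos hab' (by linarith))
  · exact isLocalMax_of_turn (G := fun x => b + (a - b) * Real.sin x ^ 2)
      (x₁ := fun t => ϑ (t - m + 1)) (x₂ := fun t => ϑ' (t - m)) h1 h2 h3 h4 hm hc hm' hc'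
      (by rw [e1]; exact hd)
      (by rw [e2]; exact hd') (mul_pos hab' hs) (mul_neg_of_pos_of_neg hab' (by linarith))

variable (hβ : ∀ i, β i < α) (hγ : ∀ j, b < γ j ∧ γ j < a) (hβ_inj : Function.Injective β)
  (hγ_inj : Function.Injective γ) (hne : A (m - 1) ≠ A m) (hne' : A m ≠ A (m + 1))
  (hr : ∃ w : Wall k l, ReflectsOff a b β γ D (A (m - 1)) (A m) (A (m + 1)) w)
include hβ hγ hβ_inj hγ_inj hne hne' hr

open Classical in
/-- The jump of the radial integral at a vertex, counted by the reflections off ellipses. -/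
theorem radial_jump :
    radialInt (a - α) (b - α) (ξ 1) - radialInt (a - α) (b - α) (ξ' 0) =
      ∑ i, ((if ReflectsOff a b β γ D (A (m - 1)) (A m) (A (m + 1)) (.ellipse i) ∧
          IsLocalMin (fun t => lam1 a b (path A t)) (m : ℝ) then (1 : ℝ) else 0) -
        (if ReflectsOff a b β γ D (A (m - 1)) (A m) (A (m + 1)) (.ellipse i) ∧
          IsLocalMax (fun t => lam1 a b (path A t)) (m : ℝ) then 1 else 0)) *
        (2 * radialInt (a - α) (b - α) √(α - β i)) := by
  by_cases hell : ∃ i, ReflectsOff a b β γ D (A (m - 1)) (A m) (A (m + 1)) (.ellipse i)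
  · obtain ⟨i, hi⟩ := hell
    have hξ := hi.radial_neg hα hab hne hne' L.state_one L'.state_zero hβ
    have hξi := (L.state_one.of_mem_ellipse hα hab (hβ i) hi.mem).1
    rw [Finset.sum_eq_single i]
    · obtain ⟨hmin, hmax⟩ := lam1_extremum hα hab L L' hξ
      rw [hξ, radialInt_neg]
      have hpos : 0 < α - β i := sub_pos.2 (hβ i)
      rcases lt_trichotomy (ξ 1) 0 with h | h | h
      · have : √(α - β i) = -ξ 1 := by
          rw [← hξi, Real.sqrt_sq_eq_abs, abs_of_neg h]
        simp only [hi, hmax h, this, radialInt_neg]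
        simp
        ring
      · rw [h] at hξi
        norm_num at hξi
        linarith
      · have : √(α - β i) = ξ 1 := by
          rw [← hξi, Real.sqrt_sq h.le]
        simp only [hi, hmin h, this]
        simp
        ring
    · intro j _ hj
      have : ¬ReflectsOff a b β γ D (A (m - 1)) (A m) (A (m + 1)) (.ellipse j) := fun hj' => by
        have := (L.state_one.of_mem_ellipse hα hab (hβ j) hj'.mem).1
        exact hj (hβ_inj (by linarith))
      simp [this]
    · simp
  · push Not at hell
    obtain ⟨w, hw⟩ := hr
    rw [hw.radial_eq hα hab hne hne' L.state_one L'.state_zero hβ hγ hβ_inj hγ_inj hell]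
    simp [hell]

open Classical in
/-- The jump of a `π`-periodic function of the angle at a vertex, counted by the reflections off
hyperbolas. The reflections off the axes do not contribute, since at an axis `ϑ` and `-ϑ` differ by
a multiple of `π`. -/
theorem angular_jump {Φ : ℝ → ℝ} (hΦ : ∀ x (n : ℤ), Φ (x + n * Real.pi) = Φ x) :
    Φ (ϑ 1) - Φ (ϑ' 0) =
      ∑ j, ((if ReflectsOff a b β γ D (A (m - 1)) (A m) (A (m + 1)) (.hyperbola j) ∧
          IsLocalMin (fun t => lam2 a b (path A t)) (m : ℝ) then (1 : ℝ) else 0) -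
        (if ReflectsOff a b β γ D (A (m - 1)) (A m) (A (m + 1)) (.hyperbola j) ∧
          IsLocalMax (fun t => lam2 a b (path A t)) (m : ℝ) then 1 else 0)) *
        (Φ (-hyperbolaAngle a b (γ j)) - Φ (hyperbolaAngle a b (γ j))) := by
  obtain ⟨-, hcos, hsin⟩ := L.state_one.coord_eq hα hab L'.state_zero
  have hε : ε ≠ 0 := by rcases L.state_one.sign with h | h <;> simp [h]
  have hflip : ε' = -ε → Real.sin (ϑ' 0) = -Real.sin (ϑ 1) ∧ Φ (ϑ' 0) = Φ (-ϑ 1) := by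
    rintro h
    have hs : Real.sin (ϑ' 0) = -Real.sin (ϑ 1) := by
      rw [h] at hsin
      exact mul_left_cancel₀ hε (by linarith)
    obtain ⟨n, hn⟩ := eq_add_two_pi_of_cos_sin_eq (x := ϑ' 0) (y := -ϑ 1)
      (by rw [Real.cos_neg, hcos]) (by rw [Real.sin_neg, hs])
    refine ⟨hs, ?_⟩
    rw [hn, ← hΦ (-ϑ 1) (2 * n)]
    congr 1
    push_cast
    ring
  by_cases hhyp : ∃ j, ReflectsOff a b β γ D (A (m - 1)) (A m) (A (m + 1)) (.hyperbola j)
  · obtain ⟨j, hj⟩ := hhyp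
    obtain ⟨hs', hΦ'⟩ := hflip
      (hj.sense_neg (w := .hyperbola j) hα hab hne hne' L.state_one L'.state_zero hγ
        trivial)
    have hs := (L.state_one.of_mem_hyperbola hα hab (hγ j) hj.mem).1
    obtain ⟨⟨hj0, hj1⟩, hjs⟩ := hyperbolaAngle_mem (hγ j)
    obtain ⟨hmin, hmax⟩ := lam2_extremum hα hab L L' (by rw [hs', hcos]; ring)
    have hsc : 0 < 2 * Real.sin (hyperbolaAngle a b (γ j)) *
        Real.cos (hyperbolaAngle a b (γ j)) := by
      rw [← Real.sin_two_mul]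
      exact Real.sin_pos_of_pos_of_lt_pi (by linarith) (by linarith)
    rw [Finset.sum_eq_single j]
    · rw [hΦ']
      obtain ⟨n, hn | hn⟩ := eq_add_int_mul_pi_of_sin_sq_eq (hs.trans hjs.symm)
      · have h2 : 0 < Real.sin (ϑ 1) * Real.cos (ϑ 1) := by
          have : Real.sin (2 * ϑ 1) = Real.sin (2 * hyperbolaAngle a b (γ j)) := by
            rw [hn, ← Real.sin_add_int_mul_two_pi (2 * hyperbolaAngle a b (γ j)) n]
            congr 1; ring
          rw [Real.sin_two_mul, Real.sin_two_mul] at this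
          linarith
        have h3 : Φ (-ϑ 1) = Φ (-hyperbolaAngle a b (γ j)) := by
          rw [hn, ← hΦ (-hyperbolaAngle a b (γ j)) (-n)]
          congr 1; push_cast; ring
        rw [h3, hn, hΦ]
        simp only [hj, hmax h2]
        simp
      · have h2 : Real.sin (ϑ 1) * Real.cos (ϑ 1) < 0 := by
          have : Real.sin (2 * ϑ 1) = -Real.sin (2 * hyperbolaAngle a b (γ j)) := by
            rw [hn, ← Real.sin_neg,
              ← Real.sin_add_int_mul_two_pi (-(2 * hyperbolaAngle a b (γ j))) n]
            congr 1; ring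
          rw [Real.sin_two_mul, Real.sin_two_mul] at this
          linarith
        have h3 : Φ (-ϑ 1) = Φ (hyperbolaAngle a b (γ j)) := by
          rw [hn, ← hΦ (hyperbolaAngle a b (γ j)) (-n)]
          congr 1; push_cast; ring
        rw [h3, hn, hΦ]
        simp only [hj, hmin h2]
        simp
    · intro i _ hi
      have : ¬ReflectsOff a b β γ D (A (m - 1)) (A m) (A (m + 1)) (.hyperbola i) := fun hi' => by
        have := (L.state_one.of_mem_hyperbola hα hab (hγ i) hi'.mem).1
        rw [hs, div_left_inj' (by linarith : a - b ≠ 0)] at this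
        exact hi (hγ_inj (by linarith))
      simp [this]
    · simp
  · push Not at hhyp
    have : Φ (ϑ' 0) = Φ (ϑ 1) := by
      by_cases hang : ∃ w : Wall k l, w.IsAngular ∧
          ReflectsOff a b β γ D (A (m - 1)) (A m) (A (m + 1)) w
      · obtain ⟨w, hw, hwr⟩ := hang
        obtain ⟨-, hΦ'⟩ := hflip
          (hwr.sense_neg hα hab hne hne' L.state_one L'.state_zero hγ hw)
        have hs := (L.state_one.of_mem_angular_wall hα hab hγ hw hwr.mem).1
        rw [hΦ']
        cases w with
        | ellipse i => exact hw.elim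
        | hyperbola j => exact absurd hwr (hhyp j)
        | xAxis =>
          obtain ⟨n, hn⟩ := Real.sin_eq_zero_iff.1 (pow_eq_zero_iff two_ne_zero |>.1 hs)
          rw [← hn, ← hΦ (n * Real.pi) (-2 * n)]
          congr 1; push_cast; ring
        | yAxis =>
          have hc : Real.cos (ϑ 1) ^ 2 = 0 := by
            rw [Real.cos_sq', hs]
            simp [Wall.sinSq]
          obtain ⟨n, hn⟩ := Real.cos_eq_zero_iff.1 (pow_eq_zero_iff two_ne_zero |>.1 hc)
          rw [hn, ← hΦ ((2 * n + 1) * Real.pi / 2) (-(2 * n + 1))]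
          congr 1; push_cast; ring
      · push Not at hang
        obtain ⟨w, hw⟩ := hr
        have := hw.sense_eq hα hab hne hne' L.state_one L'.state_zero hβ hγ hβ_inj hγ_inj hang
        rw [this] at hsin
        obtain ⟨n, hn⟩ := eq_add_two_pi_of_cos_sin_eq hcos (mul_left_cancel₀ hε hsin)
        rw [hn, ← hΦ (ϑ 1) (2 * n)]
        congr 1; push_cast; ring
    rw [this]
    simp [hhyp]

end Jumps

/-! ### The Abel-Jacobi map -/

section AbelJacobi

variable {a b α : ℝ}

lemma deriv_cubic_of_eq {e₁ e₂ e₃ : ℂ} (h : ∀ t, cubic a b α t = (e₁ - t) * (e₂ - t) * (e₃ - t))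
    (t : ℂ) : deriv (cubic a b α) t =
      -((e₂ - t) * (e₃ - t) + (e₁ - t) * (e₃ - t) + (e₁ - t) * (e₂ - t)) := by
  have hsub : ∀ c : ℂ, HasDerivAt (fun t : ℂ => c - t) (-1) t := fun c => by
    simpa using (hasDerivAt_id' t).const_sub c
  rw [funext h]
  refine ((((hsub e₁).mul (hsub e₂)).mul (hsub e₃)).congr_deriv ?_).deriv
  simp only [Pi.mul_apply]
  ring

lemma deriv_cubic (t : ℂ) : deriv (cubic a b α) t =
    -((b - t) * (α - t) + (a - t) * (α - t) + (a - t) * (b - t)) :=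
  deriv_cubic_of_eq (fun _ => rfl) t

lemma IntegralAlong.symm {P Q : ℂ × ℂ} {z : ℂ} (h : IntegralAlong a b α P Q z) :
    IntegralAlong a b α Q P (-z) := by
  induction h with
  | arc t s w hw hcurve ht hs =>
    have hmap : Set.MapsTo (fun u : ℝ => 1 - u) (Set.Icc 0 1) (Set.Icc 0 1) :=
      fun u hu => ⟨by linarith [hu.2], by linarith [hu.1]⟩
    have hsub : ∀ u, HasDerivWithinAt (fun u : ℝ => 1 - u) (-1) (Set.Icc 0 1) u := fun u => by
      simpa using ((hasDerivAt_id' u).const_sub 1).hasDerivWithinAt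
    have := IntegralAlong.arc (a := a) (b := b) (α := α) (fun u => t (1 - u))
      (fun u => s (1 - u)) (fun u => -w (1 - u))
      (hw.comp (by fun_prop) hmap).neg (fun u hu => hcurve _ (hmap hu))
      (fun u hu => ((ht _ (hmap hu)).scomp u (hsub u) hmap).congr_deriv (by simp))
      (fun u hu => ((hs _ (hmap hu)).scomp u (hsub u) hmap).congr_deriv (by simp))
    have hint : ∫ u in (0 : ℝ)..1, -w (1 - u) = -∫ u in (0 : ℝ)..1, w u := by
      rw [intervalIntegral.integral_neg, intervalIntegral.integral_comp_sub_left (fun u => w u) 1]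
      simp
    rw [hint] at this
    simpa using this
  | trans _ _ ih ih' =>
    rw [neg_add_rev]
    exact ih'.trans ih

/-- The Abel-Jacobi map may be computed along any path. -/
lemma abelJacobi_eq {P Q : ℂ × ℂ} {z : ℂ} (h : IntegralAlong a b α P Q z) :
    abelJacobi a b α P Q = QuotientAddGroup.mk z := by
  have hex : ∃ z, IntegralAlong a b α P Q z := ⟨z, h⟩
  rw [abelJacobi, dif_pos hex]
  refine QuotientAddGroup.eq.2 (AddSubgroup.subset_closure ⟨P, ?_⟩)
  rw [add_comm]
  exact h.trans hex.choose_spec.symm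

lemma abelJacobi_eq_add {P Q R : ℂ × ℂ} {y z : ℂ} (hPQ : IntegralAlong a b α P Q y)
    (hQR : IntegralAlong a b α Q R z) :
    abelJacobi a b α P R = abelJacobi a b α P Q + QuotientAddGroup.mk z := by
  rw [abelJacobi_eq hPQ, abelJacobi_eq (hPQ.trans hQR), QuotientAddGroup.mk_add]

/-! ### Path connectedness of the curve -/

lemma hasDerivAt_csqrt_comp {f : ℝ → ℂ} {f' : ℂ} {u : ℝ} (hf : HasDerivAt f f' u)
    (hu : f u ∈ Complex.slitPlane) :
    HasDerivAt (fun u => Complex.sqrt (f u)) (f' / (2 * Complex.sqrt (f u))) u := by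
  refine ((Complex.hasDerivAt_sqrt hu).comp u hf).congr_deriv ?_
  have : f u ^ (-1 / 2 : ℂ) = (Complex.sqrt (f u))⁻¹ := by
    rw [Complex.sqrt, ← Complex.cpow_neg]
    norm_num
  rw [this]
  ring

lemma csqrt_sq (z : ℂ) : Complex.sqrt z ^ 2 = z := by
  rw [Complex.sqrt]
  exact Complex.cpow_nat_inv_pow z two_ne_zero

/-- Seen from a real `e ≠ e₁`, the segment from `e₁` to a nonreal `t₁` does not leave the slit plane
around the direction of `t₁`, so that the principal root is smooth along it. -/
lemma segment_ratio_mem_slitPlane {e e₁ : ℝ} (h : e₁ ≠ e) {t₁ : ℂ} (him : t₁.im ≠ 0) (u : ℝ) :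
    ((e : ℂ) - (e₁ + (u : ℂ) ^ 2 * (t₁ - e₁))) / (e - t₁) ∈ Complex.slitPlane := by
  have hne : (e : ℂ) - t₁ ≠ 0 := fun h0 => him (by simpa using congrArg Complex.im h0)
  have hr : ((e : ℂ) - (e₁ + (u : ℂ) ^ 2 * (t₁ - e₁))) / (e - t₁) =
      ((u ^ 2 : ℝ) : ℂ) + ((1 - u ^ 2 : ℝ) : ℂ) * (((e - e₁ : ℝ) : ℂ) / (e - t₁)) := by
    push_cast
    field_simp
    ring
  have hz : (((e - e₁ : ℝ) : ℂ) / (e - t₁)).im ≠ 0 := by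
    have hN : Complex.normSq ((e : ℂ) - t₁) ≠ 0 := Complex.normSq_eq_zero.not.2 hne
    have h2 : e - e₁ ≠ 0 := sub_ne_zero.2 h.symm
    rw [Complex.div_im, Complex.ofReal_im, Complex.ofReal_re]
    simp only [Complex.sub_im, Complex.ofReal_im, zero_mul, zero_div, zero_sub]
    rw [mul_neg, neg_div, neg_neg]
    exact div_ne_zero (mul_ne_zero h2 him) hN
  rw [hr]
  by_cases hu : u ^ 2 = 1
  · simp [hu]
  · refine Complex.mem_slitPlane_iff.2 (Or.inr ?_)
    rw [Complex.add_im, Complex.ofReal_im, zero_add, Complex.im_ofReal_mul]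
    exact mul_ne_zero (sub_ne_zero.2 (Ne.symm hu)) hz

/-- Every point over a nonreal `t₁` is joined to the branch point over `e₁`. The path lies over the
straight segment; its parametrisation by `u²` makes `s` differentiable at the branch point. -/
lemma exists_integralAlong_branch {e₁ e₂ e₃ : ℝ} (h₁₂ : e₁ ≠ e₂) (h₁₃ : e₁ ≠ e₃)
    (hcubic : ∀ t, cubic a b α t = (e₁ - t) * (e₂ - t) * (e₃ - t)) {t₁ s₁ : ℂ}
    (him : t₁.im ≠ 0) (hs : (t₁, s₁) ∈ curve a b α) :
    ∃ z, IntegralAlong a b α ((e₁ : ℂ), 0) (t₁, s₁) z := by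
  have hs' : s₁ ^ 2 = (e₁ - t₁) * (e₂ - t₁) * (e₃ - t₁) := (hcubic t₁).symm ▸ hs
  have hne : ∀ e : ℝ, (e : ℂ) - t₁ ≠ 0 := fun e h0 =>
    him (by simpa using congrArg Complex.im h0)
  have hs0 : s₁ ≠ 0 := by
    intro h0
    rw [h0, zero_pow two_ne_zero] at hs'
    exact mul_ne_zero (mul_ne_zero (hne e₁) (hne e₂)) (hne e₃) hs'.symm
  have hu : ∀ u : ℝ, HasDerivAt (fun u : ℝ => (u : ℂ)) 1 u := fun u => by
    simpa using (hasDerivAt_id' u).ofReal_comp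
  have ht : ∀ u : ℝ, HasDerivAt (fun u : ℝ => (e₁ : ℂ) + (u : ℂ) ^ 2 * (t₁ - e₁))
      (2 * u * (t₁ - e₁)) u := fun u => by
    refine ((((hu u).pow 2).mul_const (t₁ - e₁)).const_add (e₁ : ℂ)).congr_deriv ?_
    push_cast
    ring
  let r : ℝ → ℝ → ℂ := fun e u =>
    Complex.sqrt (((e : ℂ) - (e₁ + (u : ℂ) ^ 2 * (t₁ - e₁))) / (e - t₁))
  have hrsq : ∀ e u : ℝ, r e u ^ 2 * (e - t₁) = e - (e₁ + (u : ℂ) ^ 2 * (t₁ - e₁)) := fun e u => by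
    change Complex.sqrt _ ^ 2 * _ = _
    rw [csqrt_sq, div_mul_cancel₀ _ (hne e)]
  have hr0 : ∀ e u : ℝ, e₁ ≠ e → r e u ≠ 0 := fun e u h h0 => by
    have h1 : r e u ^ 2 = _ := csqrt_sq _
    rw [h0, zero_pow two_ne_zero] at h1
    exact Complex.slitPlane_ne_zero (segment_ratio_mem_slitPlane h him u) h1.symm
  have hr : ∀ e u : ℝ, e₁ ≠ e →
      HasDerivAt (r e) (-(2 * u * (t₁ - e₁)) / (e - t₁) / (2 * r e u)) u := fun e u h =>
    hasDerivAt_csqrt_comp (((ht u).const_sub (e : ℂ)).div_const _)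
      (segment_ratio_mem_slitPlane h him u)
  have hr1 : ∀ e, r e 1 = 1 := fun e => by
    change Complex.sqrt _ = 1
    have : ((e : ℂ) - (e₁ + ((1 : ℝ) : ℂ) ^ 2 * (t₁ - e₁))) / (e - t₁) = 1 := by
      rw [div_eq_one_iff_eq (hne e)]; push_cast; ring
    rw [this, Complex.sqrt_one]
  have hrc : ∀ e, e₁ ≠ e → Continuous (r e) := fun e h =>
    continuous_iff_continuousAt.2 fun u => (hr e u h).continuousAt
  have key := IntegralAlong.arc (a := a) (b := b) (α := α)
    (fun u => (e₁ : ℂ) + (u : ℂ) ^ 2 * (t₁ - e₁)) (fun u => u * s₁ * r e₂ u * r e₃ u)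
    (fun u => 2 * (t₁ - e₁) / (s₁ * r e₂ u * r e₃ u)) ?_ ?_ ?_ ?_
  · simp [hr1] at key
    exact ⟨_, key⟩
  · refine (Continuous.div continuous_const
      ((continuous_const.mul (hrc e₂ h₁₂)).mul (hrc e₃ h₁₃)) fun u => ?_).continuousOn
    exact mul_ne_zero (mul_ne_zero hs0 (hr0 e₂ u h₁₂)) (hr0 e₃ u h₁₃)
  · intro u _
    change (u * s₁ * r e₂ u * r e₃ u) ^ 2 = cubic a b α _
    rw [hcubic, ← hrsq e₂, ← hrsq e₃]
    linear_combination (u : ℂ) ^ 2 * r e₂ u ^ 2 * r e₃ u ^ 2 * hs'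
  · intro u _
    refine ((ht u).congr_deriv ?_).hasDerivWithinAt
    have := hr0 e₂ u h₁₂
    have := hr0 e₃ u h₁₃
    field_simp
  · intro u _
    refine (((((hu u).mul_const s₁).mul (hr e₂ u h₁₂)).mul (hr e₃ u h₁₃)).congr_deriv
      ?_).hasDerivWithinAt
    have h2 := hr0 e₂ u h₁₂
    have h3 := hr0 e₃ u h₁₃
    have h4 := hne e₂
    have h5 := hne e₃
    rw [deriv_cubic_of_eq hcubic, ← hrsq e₂, ← hrsq e₃]
    simp only [Pi.mul_apply]
    generalize r e₂ u = x at *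
    generalize r e₃ u = y at *
    clear hr hrc hr1 hr0 hrsq
    field_simp
    rw [hs']
    ring

/-- Every point over a real `t₀` which is not a branch point is joined to a point over a nonreal
number. -/
lemma exists_integralAlong_nonreal {t₀ : ℝ} {s₀ : ℂ} (hs : ((t₀ : ℂ), s₀) ∈ curve a b α)
    (ha : t₀ ≠ a) (hb : t₀ ≠ b) (hα : t₀ ≠ α) :
    ∃ t₁ s₁ : ℂ, t₁.im ≠ 0 ∧ (t₁, s₁) ∈ curve a b α ∧
      ∃ z, IntegralAlong a b α (t₀, s₀) (t₁, s₁) z := by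
  have hs' : s₀ ^ 2 = (a - t₀) * (b - t₀) * (α - t₀) := hs
  have hne : ∀ e : ℝ, t₀ ≠ e → (e : ℂ) - t₀ ≠ 0 := fun e h => by
    rw [← Complex.ofReal_sub]
    exact Complex.ofReal_ne_zero.2 (sub_ne_zero.2 h.symm)
  have hs0 : s₀ ≠ 0 := by
    intro h0
    rw [h0, zero_pow two_ne_zero] at hs'
    exact mul_ne_zero (mul_ne_zero (hne a ha) (hne b hb)) (hne α hα) hs'.symm
  have ht : ∀ u : ℝ, HasDerivAt (fun u : ℝ => (t₀ : ℂ) + u * Complex.I) Complex.I u := fun u => by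
    simpa using ((hasDerivAt_id' u).ofReal_comp.mul_const Complex.I).const_add (t₀ : ℂ)
  let r : ℝ → ℝ → ℂ := fun e u => Complex.sqrt (((e : ℂ) - (t₀ + u * Complex.I)) / (e - t₀))
  have hslit : ∀ e u : ℝ, t₀ ≠ e →
      ((e : ℂ) - (t₀ + u * Complex.I)) / (e - t₀) ∈ Complex.slitPlane := fun e u h => by
    have h1 : ((e : ℂ) - (t₀ + u * Complex.I)) / (e - t₀) =
        1 - ((u / (e - t₀) : ℝ) : ℂ) * Complex.I := by
      have := hne e h
      push_cast
      field_simp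
      ring
    rw [h1]
    refine Complex.mem_slitPlane_iff.2 (Or.inl ?_)
    rw [Complex.sub_re, Complex.re_ofReal_mul, Complex.I_re, mul_zero, sub_zero, Complex.one_re]
    exact one_pos
  have hrsq : ∀ e u : ℝ, t₀ ≠ e → r e u ^ 2 * (e - t₀) = e - (t₀ + u * Complex.I) :=
    fun e u h => by
      change Complex.sqrt _ ^ 2 * _ = _
      rw [csqrt_sq, div_mul_cancel₀ _ (hne e h)]
  have hr0 : ∀ e u : ℝ, t₀ ≠ e → r e u ≠ 0 := fun e u h h0 => by
    have h1 : r e u ^ 2 = _ := csqrt_sq _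
    rw [h0, zero_pow two_ne_zero] at h1
    exact Complex.slitPlane_ne_zero (hslit e u h) h1.symm
  have hr : ∀ e u : ℝ, t₀ ≠ e →
      HasDerivAt (r e) (-Complex.I / (e - t₀) / (2 * r e u)) u := fun e u h =>
    hasDerivAt_csqrt_comp (((ht u).const_sub (e : ℂ)).div_const _) (hslit e u h)
  have hr1 : ∀ e, t₀ ≠ e → r e 0 = 1 := fun e h => by
    change Complex.sqrt _ = 1
    have : ((e : ℂ) - (t₀ + ((0 : ℝ) : ℂ) * Complex.I)) / (e - t₀) = 1 := by
      rw [div_eq_one_iff_eq (hne e h)]; push_cast; ring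
    rw [this, Complex.sqrt_one]
  have hrc : ∀ e, t₀ ≠ e → Continuous (r e) := fun e h =>
    continuous_iff_continuousAt.2 fun u => (hr e u h).continuousAt
  have hcurve : ∀ u : ℝ, ((t₀ : ℂ) + u * Complex.I, s₀ * r a u * r b u * r α u) ∈
      curve a b α := fun u => by
    change (s₀ * r a u * r b u * r α u) ^ 2 = cubic a b α _
    rw [cubic, ← hrsq a u ha, ← hrsq b u hb, ← hrsq α u hα]
    linear_combination r a u ^ 2 * r b u ^ 2 * r α u ^ 2 * hs'
  have key := IntegralAlong.arc (a := a) (b := b) (α := α)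
    (fun u => (t₀ : ℂ) + u * Complex.I) (fun u => s₀ * r a u * r b u * r α u)
    (fun u => Complex.I / (s₀ * r a u * r b u * r α u)) ?_ (fun u _ => hcurve u) ?_ ?_
  · simp only [hr1 a ha, hr1 b hb, hr1 α hα, Complex.ofReal_zero, zero_mul, add_zero,
      mul_one] at key
    exact ⟨_, _, by simp, hcurve 1, _, key⟩
  · refine (Continuous.div continuous_const (((continuous_const.mul (hrc a ha)).mul
      (hrc b hb)).mul (hrc α hα)) fun u => ?_).continuousOn
    exact mul_ne_zero (mul_ne_zero (mul_ne_zero hs0 (hr0 a u ha)) (hr0 b u hb)) (hr0 α u hα)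
  · intro u _
    refine ((ht u).congr_deriv ?_).hasDerivWithinAt
    have := hr0 a u ha
    have := hr0 b u hb
    have := hr0 α u hα
    field_simp
  · intro u _
    refine ((((hr a u ha).const_mul s₀).mul (hr b u hb)).mul (hr α u hα)).congr_deriv
      ?_ |>.hasDerivWithinAt
    have h1 := hr0 a u ha
    have h2 := hr0 b u hb
    have h3 := hr0 α u hα
    have h4 := hne a ha
    have h5 := hne b hb
    have h6 := hne α hα
    rw [deriv_cubic, ← hrsq a u ha, ← hrsq b u hb, ← hrsq α u hα]
    simp only [Pi.mul_apply]
    generalize r a u = x at *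
    generalize r b u = y at *
    generalize r α u = z at *
    clear hr hrc hr1 hr0 hrsq
    field_simp
    rw [hs']
    ring

/-- The affine curve is path connected. -/
theorem exists_integralAlong (hab : b < a) (hα : α < b) {P Q : ℂ × ℂ} (hP : P ∈ curve a b α)
    (hQ : Q ∈ curve a b α) : ∃ z, IntegralAlong a b α P Q z := by
  have key : ∀ P ∈ curve a b α, ∃ z, IntegralAlong a b α ((a : ℂ), 0) P z := by
    have hnr : ∀ t s : ℂ, t.im ≠ 0 → (t, s) ∈ curve a b α →
        (∃ z, IntegralAlong a b α ((a : ℂ), 0) (t, s) z) ∧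
        (∃ z, IntegralAlong a b α ((b : ℂ), 0) (t, s) z) ∧
        (∃ z, IntegralAlong a b α ((α : ℂ), 0) (t, s) z) := fun t s him hts =>
      ⟨exists_integralAlong_branch (e₁ := a) (e₂ := b) (e₃ := α) (by linarith) (by linarith)
          (fun t => rfl) him hts,
        exists_integralAlong_branch (e₁ := b) (e₂ := a) (e₃ := α) (by linarith) (by linarith)
          (fun t => by rw [cubic]; ring) him hts,
        exists_integralAlong_branch (e₁ := α) (e₂ := a) (e₃ := b) (by linarith) (by linarith)
          (fun t => by rw [cubic]; ring) him hts⟩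
    have hI : (Complex.I, Complex.sqrt (cubic a b α Complex.I)) ∈ curve a b α := csqrt_sq _
    obtain ⟨⟨za, hza⟩, ⟨zb, hzb⟩, ⟨zα, hzα⟩⟩ := hnr _ _ (by simp) hI
    rintro ⟨t, s⟩ hts
    by_cases him : t.im = 0
    · obtain ⟨t₀, rfl⟩ : ∃ t₀ : ℝ, (t₀ : ℂ) = t := ⟨t.re, Complex.ext rfl (by simp [him])⟩
      by_cases hbr : t₀ ≠ a ∧ t₀ ≠ b ∧ t₀ ≠ α
      · obtain ⟨t₁, s₁, him₁, hts₁, z, hz⟩ :=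
          exists_integralAlong_nonreal hts hbr.1 hbr.2.1 hbr.2.2
        obtain ⟨⟨y, hy⟩, -, -⟩ := hnr _ _ him₁ hts₁
        exact ⟨_, hy.trans hz.symm⟩
      · have hs0 : s = 0 := by
          have : s ^ 2 = cubic a b α t₀ := hts
          have h0 : cubic a b α t₀ = 0 := by
            rw [cubic]
            by_contra hne
            refine hbr ⟨?_, ?_, ?_⟩ <;> rintro rfl <;> simp at hne
          rw [h0] at this
          exact pow_eq_zero_iff two_ne_zero |>.1 this
        subst hs0
        by_cases ha : t₀ = a
        · subst ha; exact ⟨_, hza.trans hza.symm⟩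
        · by_cases hb : t₀ = b
          · subst hb; exact ⟨_, hza.trans hzb.symm⟩
          · have hα : t₀ = α := by tauto
            subst hα; exact ⟨_, hza.trans hzα.symm⟩
    · exact (hnr t s him hts).1
  obtain ⟨y, hy⟩ := key P hP
  obtain ⟨z, hz⟩ := key Q hQ
  exact ⟨_, hy.symm.trans hz⟩

/-! ### Real arcs of the curve -/

lemma integralAlong_of_real {t s w F : ℝ → ℝ} (hw : Continuous w)
    (hcurve : ∀ u, s u ^ 2 = (a - t u) * (b - t u) * (α - t u))
    (ht : ∀ u, HasDerivAt t (w u * s u) u)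
    (hs : ∀ u, HasDerivAt s (w u * (-((b - t u) * (α - t u) + (a - t u) * (α - t u) +
      (a - t u) * (b - t u)) / 2)) u)
    (hF : ∀ u, HasDerivAt F (w u) u) :
    IntegralAlong a b α ((t 0 : ℂ), (s 0 : ℂ)) ((t 1 : ℂ), (s 1 : ℂ)) ((F 1 - F 0 : ℝ) : ℂ) := by
  have hint : ∫ u in (0 : ℝ)..1, (w u : ℂ) = ((F 1 - F 0 : ℝ) : ℂ) := by
    rw [intervalIntegral.integral_ofReal, intervalIntegral.integral_eq_sub_of_hasDerivAt
      (fun u _ => hF u) (hw.intervalIntegrable _ _)]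
  rw [← hint]
  refine IntegralAlong.arc (fun u => (t u : ℂ)) (fun u => (s u : ℂ)) (fun u => (w u : ℂ))
    (Complex.continuous_ofReal.comp hw).continuousOn (fun u _ => ?_) (fun u _ => ?_) fun u _ => ?_
  · change (s u : ℂ) ^ 2 = cubic a b α (t u)
    rw [cubic]
    exact_mod_cast hcurve u
  · exact ((ht u).ofReal_comp.congr_deriv (by push_cast; rfl)).hasDerivWithinAt
  · refine ((hs u).ofReal_comp.congr_deriv ?_).hasDerivWithinAt
    rw [deriv_cubic]
    push_cast
    rfl

lemma csqrt_ofReal {x : ℝ} (hx : 0 ≤ x) : Complex.sqrt (x : ℂ) = (√x : ℝ) := by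
  rw [Complex.sqrt_of_nonneg (by exact_mod_cast hx), Complex.ofReal_re]

lemma csqrt_ofReal_of_nonpos {x : ℝ} (hx : x ≤ 0) :
    Complex.sqrt (x : ℂ) = Complex.I * (√(-x) : ℝ) := by
  have := Complex.sqrt_neg_of_nonneg (a := ((-x : ℝ) : ℂ)) (by exact_mod_cast neg_nonneg.2 hx)
  rw [csqrt_ofReal (neg_nonneg.2 hx)] at this
  rw [← this]
  push_cast
  rw [neg_neg]

lemma sqrtCubic_of_le {δ : ℝ} (hab : b < a) (hα : α < b) (hδ : δ ≤ α) :
    sqrtCubic a b α δ = (√(a - δ) * √(b - δ) * √(α - δ) : ℝ) := by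
  rw [sqrtCubic, csqrt_ofReal (by linarith), csqrt_ofReal (by linarith),
    csqrt_ofReal (by linarith)]
  push_cast
  rfl

lemma sqrtCubic_of_mem_Icc {δ : ℝ} (hα : α < b) (hδ : b ≤ δ) (hδ' : δ ≤ a) :
    sqrtCubic a b α δ = (-(√(a - δ) * √(δ - b) * √(δ - α)) : ℝ) := by
  rw [sqrtCubic, csqrt_ofReal (by linarith), csqrt_ofReal_of_nonpos (by linarith),
    csqrt_ofReal_of_nonpos (by linarith), neg_sub, neg_sub]
  push_cast
  linear_combination (√(a - δ) : ℂ) * √(δ - b) * √(δ - α) * Complex.I_sq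

/-- The integral of `dt / s` from the caustic to an ellipse, with `t = α - (U u)²`. -/
theorem integralAlong_radial (hab : b < a) (hα : α < b) {δ : ℝ} (hδ : δ ≤ α) :
    IntegralAlong a b α (curvePoint a b α α) (curvePoint a b α δ)
      ((-(2 * radialInt (a - α) (b - α) √(α - δ)) : ℝ) : ℂ) := by
  have hp : 0 < a - α := by linarith
  have hq : 0 < b - α := by linarith
  set U := √(α - δ) with hU
  have hU2 : U ^ 2 = α - δ := Real.sq_sqrt (by linarith)
  have hl : ∀ u, HasDerivAt (fun u : ℝ => U * u) U u := fun u => by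
    simpa using (hasDerivAt_id' u).const_mul U
  have hA : ∀ u, HasDerivAt (fun u : ℝ => √(a - α + (U * u) ^ 2)) _ u := fun u =>
    (hasDerivAt_radical hp (U * u)).comp u (hl u)
  have hB : ∀ u, HasDerivAt (fun u : ℝ => √(b - α + (U * u) ^ 2)) _ u := fun u =>
    (hasDerivAt_radical hq (U * u)).comp u (hl u)
  have key := integralAlong_of_real (a := a) (b := b) (α := α)
    (t := fun u => α - (U * u) ^ 2)
    (s := fun u => √(a - α + (U * u) ^ 2) * √(b - α + (U * u) ^ 2) * (U * u))
    (w := fun u => -(2 * U) / (√(a - α + (U * u) ^ 2) * √(b - α + (U * u) ^ 2)))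
    (F := fun u => -(2 * radialInt (a - α) (b - α) (U * u))) ?_ ?_ ?_ ?_ ?_
  · have h0 : curvePoint a b α α = (((α - (U * 0) ^ 2 : ℝ) : ℂ),
        ((√(a - α + (U * 0) ^ 2) * √(b - α + (U * 0) ^ 2) * (U * 0) : ℝ) : ℂ)) := by
      rw [curvePoint, sqrtCubic_of_le hab hα le_rfl]
      simp
    have h1 : curvePoint a b α δ = (((α - (U * 1) ^ 2 : ℝ) : ℂ),
        ((√(a - α + (U * 1) ^ 2) * √(b - α + (U * 1) ^ 2) * (U * 1) : ℝ) : ℂ)) := by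
      rw [curvePoint, sqrtCubic_of_le hab hα hδ, mul_one, hU2, ← hU]
      simp
    rw [h0, h1]
    convert key using 2
    simp [radialInt_zero]
  · refine Continuous.div (by fun_prop) (by fun_prop) fun u => ?_
    have := radical_pos hp (U * u)
    have := radical_pos hq (U * u)
    positivity
  · intro u
    rw [mul_pow, mul_pow, radical_sq hp, radical_sq hq]
    ring
  · intro u
    have := radical_pos hp (U * u)
    have := radical_pos hq (U * u)
    refine (((hl u).pow 2).const_sub α).congr_deriv ?_
    field_simp
    push_cast
    ring
  · intro u
    have h1 := radical_pos hp (U * u)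
    have h2 := radical_pos hq (U * u)
    have h3 := radical_sq hp (U * u)
    have h4 := radical_sq hq (U * u)
    refine (((hA u).mul (hB u)).mul (hl u)).congr_deriv ?_
    simp only [Pi.mul_apply]
    generalize √(a - α + (U * u) ^ 2) = A at *
    generalize √(b - α + (U * u) ^ 2) = B at *
    field_simp
    grind
  · intro u
    refine (((hasDerivAt_radialInt hp hq (U * u)).comp u (hl u)).const_mul 2).neg.congr_deriv ?_
    ring

/-- The integral of `dt / s` from the end `t = a` of the real oval over `[b, a]`, with
`t = b cos² ϑ + a sin² ϑ`. -/
theorem integralAlong_angular (hab : b < a) (hα : α < b) {δ φ : ℝ} (hφ : 0 ≤ φ)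
    (hφ' : φ ≤ Real.pi / 2) (hδ : δ = b + (a - b) * Real.sin φ ^ 2) :
    IntegralAlong a b α (curvePoint a b α a) (curvePoint a b α δ)
      ((2 * (angularInt (a - α) (b - α) (Real.pi / 2) - angularInt (a - α) (b - α) φ) : ℝ) : ℂ) := by
  have hp : 0 < a - α := by linarith
  have hq : 0 < b - α := by linarith
  set c := φ - Real.pi / 2 with hc
  have hl : ∀ u, HasDerivAt (fun u : ℝ => Real.pi / 2 + c * u) c u := fun u => by
    simpa using ((hasDerivAt_id' u).const_mul c).const_add (Real.pi / 2)
  have hS := fun u => (hl u).sin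
  have hC := fun u => (hl u).cos
  have hR : ∀ u, HasDerivAt (fun u : ℝ => angularRoot (a - α) (b - α) (Real.pi / 2 + c * u)) _ u :=
    fun u => (hasDerivAt_angularRoot hp hq _).comp u (hl u)
  have key := integralAlong_of_real (a := a) (b := b) (α := α)
    (t := fun u => b + (a - b) * Real.sin (Real.pi / 2 + c * u) ^ 2)
    (s := fun u => -((a - b) * Real.sin (Real.pi / 2 + c * u) * Real.cos (Real.pi / 2 + c * u) *
      angularRoot (a - α) (b - α) (Real.pi / 2 + c * u)))
    (w := fun u => -(2 * c) / angularRoot (a - α) (b - α) (Real.pi / 2 + c * u))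
    (F := fun u => -(2 * angularInt (a - α) (b - α) (Real.pi / 2 + c * u))) ?_ ?_ ?_ ?_ ?_
  · have hab' : 0 ≤ a - b := by linarith
    have hcs := Real.sin_sq_add_cos_sq φ
    have hs0 : 0 ≤ Real.sin φ := Real.sin_nonneg_of_nonneg_of_le_pi hφ (by linarith [Real.pi_pos])
    have hc0 : 0 ≤ Real.cos φ := Real.cos_nonneg_of_neg_pi_div_two_le_of_le (by linarith) hφ'
    have h0 : curvePoint a b α a = (((b + (a - b) * Real.sin (Real.pi / 2 + c * 0) ^ 2 : ℝ) : ℂ),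
        ((-((a - b) * Real.sin (Real.pi / 2 + c * 0) * Real.cos (Real.pi / 2 + c * 0) *
          angularRoot (a - α) (b - α) (Real.pi / 2 + c * 0)) : ℝ) : ℂ)) := by
      rw [curvePoint, sqrtCubic_of_mem_Icc hα hab.le le_rfl]
      simp
    have h1 : curvePoint a b α δ = (((b + (a - b) * Real.sin (Real.pi / 2 + c * 1) ^ 2 : ℝ) : ℂ),
        ((-((a - b) * Real.sin (Real.pi / 2 + c * 1) * Real.cos (Real.pi / 2 + c * 1) *
          angularRoot (a - α) (b - α) (Real.pi / 2 + c * 1)) : ℝ) : ℂ)) := by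
      have e1 : a - δ = (a - b) * Real.cos φ ^ 2 := by rw [hδ]; linear_combination (b - a) * hcs
      have e2 : δ - b = (a - b) * Real.sin φ ^ 2 := by rw [hδ]; ring
      have e3 : δ - α = (b - α) * Real.cos φ ^ 2 + (a - α) * Real.sin φ ^ 2 := by
        rw [hδ]; linear_combination (α - b) * hcs
      have e4 : Real.pi / 2 + c * 1 = φ := by rw [hc]; ring
      rw [curvePoint, sqrtCubic_of_mem_Icc hα (by nlinarith [sq_nonneg (Real.sin φ)])
        (by nlinarith [sq_nonneg (Real.cos φ)]), e4, ← hδ, e1, e2, e3, ← angularRoot,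
        Real.sqrt_mul hab', Real.sqrt_mul hab', Real.sqrt_sq hs0, Real.sqrt_sq hc0]
      refine Prod.ext rfl ?_
      have h5 : √(a - b) * √(a - b) = a - b := Real.mul_self_sqrt hab'
      simp only [Complex.ofReal_inj]
      linear_combination (-Real.sin φ * Real.cos φ * angularRoot (a - α) (b - α) φ) * h5
    rw [h0, h1]
    convert key using 2
    have e4 : Real.pi / 2 + c * 1 = φ := by rw [hc]; ring
    rw [e4]
    simp
    ring
  · exact Continuous.div (by fun_prop) (continuous_angularRoot.comp (by fun_prop)) fun u =>
      (angularRoot_pos hp hq _).ne'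
  · intro u
    have h1 := angularRoot_sq hp hq (Real.pi / 2 + c * u)
    have h2 := Real.sin_sq_add_cos_sq (Real.pi / 2 + c * u)
    generalize Real.sin (Real.pi / 2 + c * u) = x at *
    generalize Real.cos (Real.pi / 2 + c * u) = y at *
    generalize angularRoot (a - α) (b - α) (Real.pi / 2 + c * u) = ρ at *
    grind
  · intro u
    have h1 := (angularRoot_pos hp hq (Real.pi / 2 + c * u)).ne'
    refine ((((hS u).pow 2).const_mul (a - b)).const_add b).congr_deriv ?_
    push_cast
    generalize angularRoot (a - α) (b - α) (Real.pi / 2 + c * u) = ρ at *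
    field_simp
  · intro u
    have h0 := angularRoot_pos hp hq (Real.pi / 2 + c * u)
    have h1 := angularRoot_sq hp hq (Real.pi / 2 + c * u)
    have h2 := Real.sin_sq_add_cos_sq (Real.pi / 2 + c * u)
    refine ((((hS u).const_mul (a - b)).mul (hC u)).mul (hR u)).neg.congr_deriv ?_
    simp only [Pi.mul_apply]
    generalize Real.sin (Real.pi / 2 + c * u) = x at *
    generalize Real.cos (Real.pi / 2 + c * u) = y at *
    generalize angularRoot (a - α) (b - α) (Real.pi / 2 + c * u) = ρ at *
    field_simp
    grind
  · intro u
    refine (((hasDerivAt_angularInt hp hq _).comp u (hl u)).const_mul 2).neg.congr_deriv ?_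
    ring

end AbelJacobi

/-! ### Summation over a period -/

section Period

variable {k l : ℕ} {a b α : ℝ} {β : Fin k → ℝ} {γ : Fin l → ℝ} {D : Set Plane}
  {A : ℤ → Plane} {N : ℕ}

/-- Summation by parts over a period: the increments along the sides are regrouped into the jumps
at the vertices. -/
lemma sum_sides_eq_sum_jumps {h₀ h₁ : ℤ → ℝ} (hper : ∀ m, h₁ (m + N) = h₁ m) :
    ∑ n ∈ Finset.range N, (h₁ n - h₀ n) = ∑ n ∈ Finset.range N, (h₁ (n - 1) - h₀ n) := by
  rw [← sub_eq_zero, ← Finset.sum_sub_distrib]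
  have h := Finset.sum_range_sub (fun n : ℕ => h₁ ((n : ℤ) - 1)) N
  have hN : h₁ ((N : ℤ) - 1) = h₁ (((0 : ℕ) : ℤ) - 1) := by
    rw [← hper (((0 : ℕ) : ℤ) - 1)]
    congr 1
  rw [hN, sub_self] at h
  rw [← h]
  refine Finset.sum_congr rfl fun n _ => ?_
  push_cast
  rw [add_sub_cancel_right]
  ring

/-- A choice of lifts of all sides of the trajectory, with the period of the trajectory. -/
lemma exists_periodic_lifts (hα : α < b) (hab : b < a)
    (hA : IsClosedTrajectory a b β γ D A N) (hcaustic : IsCaustic a b α A) :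
    ∃ (ε : ℤ → ℝ) (ξ ϑ : ℤ → ℝ → ℝ),
      (∀ m, IsTangentLift (a - α) (b - α) (A m) (A (m + 1)) (ε m) (ξ m) (ϑ m)) ∧
      (∀ m, ξ (m + N) = ξ m) ∧ ∀ m, ϑ (m + N) = ϑ m := by
  have h : ∀ P Q : Plane, ∃ (ε : ℝ) (ξ ϑ : ℝ → ℝ), P ≠ Q → IsTangentLine a b α P Q →
      IsTangentLift (a - α) (b - α) P Q ε ξ ϑ := fun P Q => by
    by_cases hPQ : P ≠ Q ∧ IsTangentLine a b α P Q
    · obtain ⟨ε, ξ, ϑ, h⟩ := exists_isTangentLift hab hα hPQ.1 hPQ.2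
      exact ⟨ε, ξ, ϑ, fun _ _ => h⟩
    · exact ⟨0, id, id, fun h h' => absurd ⟨h, h'⟩ hPQ⟩
  choose ε ξ ϑ hL using h
  have hper : ∀ m, A (m + N + 1) = A (m + 1) := fun m => by
    rw [← hA.periodic (m + 1)]
    congr 1
    ring
  refine ⟨fun m => ε (A m) (A (m + 1)), fun m => ξ (A m) (A (m + 1)),
    fun m => ϑ (A m) (A (m + 1)), fun m => hL _ _ (hA.ne m) (hcaustic m), fun m => ?_, fun m => ?_⟩
  · simp only [hper, hA.periodic]
  · simp only [hper, hA.periodic]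

open Classical in
lemma insideCount_eq_sum (w : Wall k l) : (insideCount a b β γ D A N w : ℝ) =
    ∑ n ∈ Finset.range N,
      if ReflectsOff a b β γ D (A ((n : ℤ) - 1)) (A n) (A (n + 1)) w ∧
        IsLocalMin (fun t => w.coord a b (path A t)) ((n : ℤ) : ℝ) then (1 : ℝ) else 0 := by
  have := ncard_int_eq_sum N fun m => ReflectsOff a b β γ D (A (m - 1)) (A m) (A (m + 1)) w ∧
    IsLocalMin (fun t => w.coord a b (path A t)) (m : ℝ)
  have := congrArg (Int.cast : ℤ → ℝ) this
  push_cast at this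
  exact this

open Classical in
lemma outsideCount_eq_sum (w : Wall k l) : (outsideCount a b β γ D A N w : ℝ) =
    ∑ n ∈ Finset.range N,
      if ReflectsOff a b β γ D (A ((n : ℤ) - 1)) (A n) (A (n + 1)) w ∧
        IsLocalMax (fun t => w.coord a b (path A t)) ((n : ℤ) : ℝ) then (1 : ℝ) else 0 := by
  have := ncard_int_eq_sum N fun m => ReflectsOff a b β γ D (A (m - 1)) (A m) (A (m + 1)) w ∧
    IsLocalMax (fun t => w.coord a b (path A t)) (m : ℝ)
  have := congrArg (Int.cast : ℤ → ℝ) this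
  push_cast at this
  exact this

/-- The particle is on the `x`-axis when `ϑ ∈ πℤ`, and on the `y`-axis when `ϑ ∈ π/2 + πℤ`. Each
side contributes its starting point and not its end point. -/
lemma axisCounts_eq_sum (hα : α < b) (hab : b < a) {ε : ℤ → ℝ} {ξ ϑ : ℤ → ℝ → ℝ}
    (hL : ∀ m, IsTangentLift (a - α) (b - α) (A m) (A (m + 1)) (ε m) (ξ m) (ϑ m)) :
    (xAxisCount A N : ℤ) = ∑ n ∈ Finset.range N,
      (⌈ϑ n 1 / Real.pi⌉ - ⌈ϑ n 0 / Real.pi⌉) ∧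
    (yAxisCount A N : ℤ) = ∑ n ∈ Finset.range N,
      (⌈(ϑ n 1 - Real.pi / 2) / Real.pi⌉ - ⌈(ϑ n 0 - Real.pi / 2) / Real.pi⌉) := by
  have hp : 0 < a - α := by linarith
  have hq : 0 < b - α := by linarith
  constructor
  · refine (ncard_eq_sum_unit_intervals (fun t => path A t 1 = 0)
      (fun n => ⌈ϑ n 1 / Real.pi⌉ - ⌈ϑ n 0 / Real.pi⌉) (fun n => ?_) N).2
    have h := ncard_crossings (hL n).strictMono_angle (hL n).continuous_angle n 0
    simp only [sub_zero, add_zero] at h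
    have hset : {t : ℝ | (n : ℝ) ≤ t ∧ t < n + 1 ∧ path A t 1 = 0} =
        {t : ℝ | (n : ℝ) ≤ t ∧ t < n + 1 ∧ ∃ j : ℤ, ϑ n (t - n) = j * Real.pi} := by
      refine Set.ext fun t => and_congr_right fun h1 => and_congr_right fun h2 => ?_
      have hε : ε n ≠ 0 := by rcases ((hL n).state 0).sign with h | h <;> simp [h]
      have hs := (hL n).state (t - n)
      rw [path_of_mem_Ico A n (by exact_mod_cast h1) (by exact_mod_cast h2), Int.cast_natCast,
        hs.pos_y]
      have := (radical_pos hq (ξ n (t - n))).ne'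
      simp only [mul_eq_zero, hε, this, false_or, Real.sin_eq_zero_iff]
      exact exists_congr fun j => eq_comm
    rwa [hset]
  · refine (ncard_eq_sum_unit_intervals (fun t => path A t 0 = 0)
      (fun n => ⌈(ϑ n 1 - Real.pi / 2) / Real.pi⌉ - ⌈(ϑ n 0 - Real.pi / 2) / Real.pi⌉)
      (fun n => ?_) N).2
    have h := ncard_crossings (hL n).strictMono_angle (hL n).continuous_angle n (Real.pi / 2)
    have hset : {t : ℝ | (n : ℝ) ≤ t ∧ t < n + 1 ∧ path A t 0 = 0} =
        {t : ℝ | (n : ℝ) ≤ t ∧ t < n + 1 ∧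
          ∃ j : ℤ, ϑ n (t - n) = j * Real.pi + Real.pi / 2} := by
      refine Set.ext fun t => and_congr_right fun h1 => and_congr_right fun h2 => ?_
      have hs := (hL n).state (t - n)
      rw [path_of_mem_Ico A n (by exact_mod_cast h1) (by exact_mod_cast h2), Int.cast_natCast,
        hs.pos_x]
      have := (radical_pos hp (ξ n (t - n))).ne'
      simp only [mul_eq_zero, this, false_or, Real.cos_eq_zero_iff]
      refine exists_congr fun j => ?_
      rw [show (2 * (j : ℝ) + 1) * Real.pi / 2 = j * Real.pi + Real.pi / 2 by ring]
    rwa [hset]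

/-- The two closing conditions as equations between real numbers. Summed over a period, the radial
and the angular integrals along the sides agree; the sums are evaluated with `radial_jump` and
`angular_jump`. -/
theorem closing_conditions (hα : α < b) (hab : b < a) (hβ : ∀ i, β i < α)
    (hγ : ∀ j, b < γ j ∧ γ j < a) (hβ_inj : Function.Injective β)
    (hγ_inj : Function.Injective γ)
    (hA : IsClosedTrajectory a b β γ D A N) (hcaustic : IsCaustic a b α A) :
    ∑ i, ((insideCount a b β γ D A N (.ellipse i) : ℝ) -
        outsideCount a b β γ D A N (.ellipse i)) *
        (2 * radialInt (a - α) (b - α) √(α - β i)) =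
      ∑ j, ((insideCount a b β γ D A N (.hyperbola j) : ℝ) -
        outsideCount a b β γ D A N (.hyperbola j)) *
        (2 * (angularInt (a - α) (b - α) (Real.pi / 2) -
          angularInt (a - α) (b - α) (hyperbolaAngle a b (γ j)))) +
        xAxisCount A N * (2 * angularInt (a - α) (b - α) (Real.pi / 2)) ∧
    ∑ j, ((insideCount a b β γ D A N (.hyperbola j) : ℝ) -
        outsideCount a b β γ D A N (.hyperbola j)) + xAxisCount A N - yAxisCount A N = 0 := by
  classical
  have hp : 0 < a - α := by linarith
  have hq : 0 < b - α := by linarith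
  obtain ⟨ε, ξ, ϑ, hL, hξ, hϑ⟩ := exists_periodic_lifts hα hab hA hcaustic
  have hL' : ∀ m : ℤ, IsTangentLift (a - α) (b - α) (A (m - 1)) (A m) (ε (m - 1)) (ξ (m - 1))
      (ϑ (m - 1)) := fun m => by
    simpa using hL (m - 1)
  have hne' : ∀ m : ℤ, A (m - 1) ≠ A m := fun m => by simpa using hA.ne (m - 1)
  obtain ⟨hx, hy⟩ := axisCounts_eq_sum (N := N) hα hab hL
  -- the sum of the radial increments
  have hrad : ∑ n ∈ Finset.range N, (radialInt (a - α) (b - α) (ξ n 1) -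
      radialInt (a - α) (b - α) (ξ n 0)) =
      ∑ i, ((insideCount a b β γ D A N (.ellipse i) : ℝ) -
        outsideCount a b β γ D A N (.ellipse i)) *
        (2 * radialInt (a - α) (b - α) √(α - β i)) := by
    rw [sum_sides_eq_sum_jumps (h₀ := fun m => radialInt (a - α) (b - α) (ξ m 0))
      (h₁ := fun m => radialInt (a - α) (b - α) (ξ m 1)) (fun m => by rw [hξ]),
      Finset.sum_congr rfl fun (n : ℕ) _ => radial_jump hα hab (hL' n) (hL n) hβ hγ hβ_inj hγ_inj
        (hne' n) (hA.ne n) (hA.reflection n), Finset.sum_comm]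
    refine Finset.sum_congr rfl fun i _ => ?_
    rw [← Finset.sum_mul, Finset.sum_sub_distrib, insideCount_eq_sum, outsideCount_eq_sum]
    rfl
  -- the sum of the increments of a periodic function of the angle
  have hang : ∀ Φ : ℝ → ℝ, (∀ x (n : ℤ), Φ (x + n * Real.pi) = Φ x) →
      ∑ n ∈ Finset.range N, (Φ (ϑ n 1) - Φ (ϑ n 0)) =
      ∑ j, ((insideCount a b β γ D A N (.hyperbola j) : ℝ) -
        outsideCount a b β γ D A N (.hyperbola j)) *
        (Φ (-hyperbolaAngle a b (γ j)) - Φ (hyperbolaAngle a b (γ j))) := by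
    intro Φ hΦ
    rw [sum_sides_eq_sum_jumps (h₀ := fun m => Φ (ϑ m 0))
      (h₁ := fun m => Φ (ϑ m 1)) (fun m => by rw [hϑ]),
      Finset.sum_congr rfl fun (n : ℕ) _ => angular_jump hα hab (hL' n) (hL n) hβ hγ hβ_inj hγ_inj
        (hne' n) (hA.ne n) (hA.reflection n) hΦ, Finset.sum_comm]
    refine Finset.sum_congr rfl fun i _ => ?_
    rw [← Finset.sum_mul, Finset.sum_sub_distrib, insideCount_eq_sum, outsideCount_eq_sum]
    rfl
  have hπ := Real.pi_pos
  have hceil : ∀ (x : ℝ) (n : ℤ), ⌈(x + n * Real.pi) / Real.pi⌉ = ⌈x / Real.pi⌉ + n :=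
    fun x n => by
      rw [add_div, mul_div_cancel_right₀ _ hπ.ne', Int.ceil_add_intCast]
  have hc1 : ∀ j, ⌈hyperbolaAngle a b (γ j) / Real.pi⌉ = 1 := fun j => by
    obtain ⟨⟨h0, h1⟩, -⟩ := hyperbolaAngle_mem (hγ j)
    rw [Int.ceil_eq_iff]
    constructor
    · have := div_pos h0 hπ
      push_cast; linarith
    · rw [div_le_iff₀ hπ]
      push_cast; linarith
  have hc2 : ∀ j, ⌈-hyperbolaAngle a b (γ j) / Real.pi⌉ = 0 := fun j => by
    obtain ⟨⟨h0, h1⟩, -⟩ := hyperbolaAngle_mem (hγ j)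
    rw [Int.ceil_eq_iff]
    constructor
    · rw [lt_div_iff₀ hπ]
      push_cast; linarith
    · rw [div_le_iff₀ hπ]
      push_cast; linarith
  have hc3 : ∀ j, ⌈(hyperbolaAngle a b (γ j) - Real.pi / 2) / Real.pi⌉ = 0 := fun j => by
    obtain ⟨⟨h0, h1⟩, -⟩ := hyperbolaAngle_mem (hγ j)
    rw [Int.ceil_eq_iff]
    constructor
    · rw [lt_div_iff₀ hπ]
      push_cast; linarith
    · rw [div_le_iff₀ hπ]
      push_cast; linarith
  have hc4 : ∀ j, ⌈(-hyperbolaAngle a b (γ j) - Real.pi / 2) / Real.pi⌉ = 0 := fun j => by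
    obtain ⟨⟨h0, h1⟩, -⟩ := hyperbolaAngle_mem (hγ j)
    rw [Int.ceil_eq_iff]
    constructor
    · rw [lt_div_iff₀ hπ]
      push_cast; linarith
    · rw [div_le_iff₀ hπ]
      push_cast; linarith
  set K := angularInt (a - α) (b - α) (Real.pi / 2) with hK
  have hxR : (xAxisCount A N : ℝ) = ∑ n ∈ Finset.range N,
      ((⌈ϑ n 1 / Real.pi⌉ : ℝ) - ⌈ϑ n 0 / Real.pi⌉) := by
    exact_mod_cast hx
  have hyR : (yAxisCount A N : ℝ) = ∑ n ∈ Finset.range N,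
      ((⌈(ϑ n 1 - Real.pi / 2) / Real.pi⌉ : ℝ) - ⌈(ϑ n 0 - Real.pi / 2) / Real.pi⌉) := by
    exact_mod_cast hy
  constructor
  -- the angular integral minus its secular part, which the crossings of the `x`-axis account for
  · have h1 := hang (fun x => angularInt (a - α) (b - α) x - 2 * K * ⌈x / Real.pi⌉) fun x n => by
      simp only [hceil, angularInt_add_int_mul_pi hp hq, ← hK]
      push_cast
      ring
    simp only [hc1, hc2, angularInt_neg] at h1
    have h2 : ∑ n ∈ Finset.range N, (radialInt (a - α) (b - α) (ξ n 1) -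
        radialInt (a - α) (b - α) (ξ n 0)) =
        ∑ n ∈ Finset.range N, ((angularInt (a - α) (b - α) (ϑ n 1) - 2 * K * ⌈ϑ n 1 / Real.pi⌉) -
          (angularInt (a - α) (b - α) (ϑ n 0) - 2 * K * ⌈ϑ n 0 / Real.pi⌉)) +
        xAxisCount A N * (2 * K) := by
      rw [hxR, Finset.sum_mul, ← Finset.sum_add_distrib]
      refine Finset.sum_congr rfl fun n _ => ?_
      linear_combination -(hL n).integral_eq 0 1
    rw [← hrad, h2, h1]
    congr 1
    refine Finset.sum_congr rfl fun j _ => ?_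
    push_cast
    ring
  -- the crossings of the two axes alternate as long as the sense of rotation is kept
  · have h1 := hang (fun x => (⌈x / Real.pi⌉ : ℝ) - ⌈(x - Real.pi / 2) / Real.pi⌉) fun x n => by
      have : x + n * Real.pi - Real.pi / 2 = x - Real.pi / 2 + n * Real.pi := by ring
      simp only [this, hceil]
      push_cast
      ring
    simp only [hc1, hc2, hc3, hc4] at h1
    have h2 : (xAxisCount A N : ℝ) - yAxisCount A N =
        ∑ n ∈ Finset.range N, (((⌈ϑ n 1 / Real.pi⌉ : ℝ) - ⌈(ϑ n 1 - Real.pi / 2) / Real.pi⌉) -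
          ((⌈ϑ n 0 / Real.pi⌉ : ℝ) - ⌈(ϑ n 0 - Real.pi / 2) / Real.pi⌉)) := by
      rw [hxR, hyR, ← Finset.sum_sub_distrib]
      exact Finset.sum_congr rfl fun n _ => by ring
    rw [add_sub_assoc, h2, h1, ← Finset.sum_add_distrib]
    refine Finset.sum_eq_zero fun j _ => ?_
    push_cast
    ring

end Period

/-- The passage from real numbers to an abelian group such as `ℂ` modulo periods: the second
hypothesis disposes of the real parts, the first one of the common point `X`. -/
lemma sum_smul_eq_zero {G : Type*} [AddCommGroup G] (φ : ℝ →+ G) (X : G) {k l : ℕ}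
    (n : Fin k → ℤ) (m : Fin l → ℤ) (p q : ℕ) (x : Fin k → ℝ) (y : Fin l → ℝ) (z : ℝ)
    (h₀ : ∑ j, m j + p - q = 0) (h₁ : ∑ i, n i * x i + ∑ j, m j * y j + p * z = 0) :
    ∑ i, n i • φ (x i) + ∑ j, m j • (X + φ (y j)) + p • (X + φ z) - q • X = 0 := by
  have e₁ : ∑ i, n i • φ (x i) + ∑ j, m j • φ (y j) + p • φ z = 0 := by
    simp only [← map_zsmul, ← map_nsmul, ← map_sum, ← map_add, zsmul_eq_mul, nsmul_eq_mul, h₁,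
      map_zero]
  have e₂ : (∑ j, m j) • X + p • X - q • X = 0 := by
    rw [← natCast_zsmul, ← natCast_zsmul, ← add_smul, ← sub_smul, h₀, zero_smul]
  simp only [smul_add, Finset.sum_add_distrib, ← Finset.sum_smul]
  calc _ = (∑ i, n i • φ (x i) + ∑ j, m j • φ (y j) + p • φ z) +
        ((∑ j, m j) • X + p • X - q • X) := by abel
    _ = 0 := by rw [e₁, e₂, add_zero]

end ConfocalBilliard
end

open ConfocalBilliard in
theorem mainTheorem3 (a b α₀ : ℝ) (hb : 0 < b) (hab : b < a)
    (k l : ℕ) (hk : 1 ≤ k) (β : Fin k → ℝ) (γ : Fin l → ℝ)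
    (hβ_inj : Function.Injective β) (hγ_inj : Function.Injective γ)
    (hβ : ∀ i, β i < α₀) (hα₀ : α₀ < b) (hγ : ∀ j, b < γ j ∧ γ j < a)
    (D : Set Plane) (hD : IsConfocalDomain a b β γ D)
    (A : ℤ → Plane) (N : ℕ) (hA : IsClosedTrajectory a b β γ D A N)
    (hcaustic : IsCaustic a b α₀ A)
    (n' n'' : Fin k → ℕ) (m' m'' : Fin l → ℕ) (p q : ℕ)
    (hn' : ∀ i, insideCount a b β γ D A N (.ellipse i) = n' i)
    (hn'' : ∀ i, outsideCount a b β γ D A N (.ellipse i) = n'' i)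
    (hm' : ∀ j, insideCount a b β γ D A N (.hyperbola j) = m' j)
    (hm'' : ∀ j, outsideCount a b β γ D A N (.hyperbola j) = m'' j)
    (hp : xAxisCount A N = p) (hq : yAxisCount A N = q)
    (P₀ : ℂ × ℂ) (hP₀ : P₀ ∈ curve a b α₀) :
    ∑ i, ((n' i : ℤ) - n'' i) •
          (abelJacobi a b α₀ P₀ (curvePoint a b α₀ (β i)) -
            abelJacobi a b α₀ P₀ (curvePoint a b α₀ α₀)) +
        ∑ j, ((m' j : ℤ) - m'' j) • abelJacobi a b α₀ P₀ (curvePoint a b α₀ (γ j)) +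
        p • abelJacobi a b α₀ P₀ (curvePoint a b α₀ b) -
        q • abelJacobi a b α₀ P₀ (curvePoint a b α₀ a) = 0 ∧
      (∑ j, ((m' j : ℤ) - m'' j)) + p - q = 0 := by
  obtain ⟨h1, h2⟩ := closing_conditions hα₀ hab hβ hγ hβ_inj hγ_inj hA hcaustic
  simp only [hn', hn'', hm', hm'', hp, hq] at h1 h2
  have h2' : (∑ j, ((m' j : ℤ) - m'' j)) + p - q = 0 := by exact_mod_cast h2
  refine ⟨?_, h2'⟩
  obtain ⟨y, hy⟩ := exists_integralAlong hab hα₀ hP₀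
    (show curvePoint a b α₀ α₀ ∈ curve a b α₀ by
      simp [curve, curvePoint, sqrtCubic, cubic])
  obtain ⟨z, hz⟩ := exists_integralAlong hab hα₀ hP₀
    (show curvePoint a b α₀ a ∈ curve a b α₀ by
      simp [curve, curvePoint, sqrtCubic, cubic])
  have eβ := fun i => abelJacobi_eq_add hy (integralAlong_radial hab hα₀ (hβ i).le)
  have eγ := fun j => by
    obtain ⟨⟨h0, h1⟩, h2⟩ := hyperbolaAngle_mem (hγ j)
    exact abelJacobi_eq_add hz (integralAlong_angular (δ := γ j) hab hα₀ h0.le h1.le (by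
      rw [h2, mul_div_cancel₀ _ (by linarith : a - b ≠ 0)]; ring))
  have eb := abelJacobi_eq_add hz (integralAlong_angular (δ := b) (φ := 0) hab hα₀ le_rfl
    (by positivity) (by simp))
  rw [angularInt_zero, sub_zero] at eb
  -- the real numbers modulo periods
  let φ : ℝ →+ ℂ ⧸ periods a b α₀ :=
    (QuotientAddGroup.mk' (periods a b α₀)).comp (Complex.ofRealHom : ℝ →+ ℂ)
  have hφ : ∀ x : ℝ, (QuotientAddGroup.mk (x : ℂ) : ℂ ⧸ periods a b α₀) = φ x := fun x => rfl
  simp only [eβ, eγ, eb, hφ, add_sub_cancel_left]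
  refine sum_smul_eq_zero φ _ _ _ p q _ _ _ h2' ?_
  simp only [mul_neg, Finset.sum_neg_distrib]
  push_cast
  linarith
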